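/- For a discrete group $G$, a $G$-complex is a Hausdorff CW complex $X$ on which $G$ acts by homeomorphisms permuting the open cells of each dimension, such that whenever $g\in G$ maps an open cell to itself, $g$ fixes that cell pointwise. For each ordinal $\alpha$ define a class ${\bf H}_\alpha\mathfrak F$ of groups by transfinite recursion: ${\bf H}_0\mathfrak F=\mathfrak F$ is the class of all finite groups; ${\bf H}_{\alpha+1}\mathfrak F$ is the class of all groups $G$ that admit a finite-dimensional contractible $G$-complex such that the stabilizer $G_x$ of every point $x$ belongs to ${\bf H}_\alpha\mathfrak F$; and ${\bf H}_\alpha\mathfrak F=\bigcup_{\beta<\alpha}{\bf H}_\beta\mathfrak F$ if $\alpha$ is a nonzero limit ordinal. Let $G$ be a finitely generated soluble group of derived length $d$, that is, $d$ is the least integer $n\ge 0$ such that the $n$-th term $G^{(n)}$ of the derived series ($G^{(0)}=G$, $G^{(n+1)}=[G^{(n)},G^{(n)}]$) is trivial. Then $G$ belongs to ${\bf H}_d\mathfrak F$. -/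

import Mathlib

universe u

/-- A class of (discrete) groups, given by its membership predicate. -/
abbrev GroupClass : Type (u + 1) := ∀ (G : Type u) [Group G], Prop

/-- The class `𝔉` of all finite groups. -/
def finiteGroups : GroupClass.{u} := fun G _ => Finite G

open Topology in
/-- `X`, with its given CW structure and `G`-action, is a `G`-complex (a `G`-CW-complex) for the
discrete group `G`: `X` is a Hausdorff CW complex on which `G` acts by homeomorphisms, the action
permutes the open cells (of each dimension), and an element that maps an open cell to itself fixes
that cell pointwise. For discrete `G` these are exactly the spaces obtained by successively
attaching equivariant cells `G/H × Dⁿ` along `G/H × Sⁿ⁻¹`. -/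
structure IsGComplex (G X : Type u) [Group G] [TopologicalSpace X] [MulAction G X]
    [CWComplex (Set.univ : Set X)] : Prop where
  t2 : T2Space X
  continuous_smul (g : G) : Continuous fun x : X => g • x
  smul_openCell (g : G) (n : ℕ) (i : RelCWComplex.cell (Set.univ : Set X) n) :
    ∃ j : RelCWComplex.cell (Set.univ : Set X) n,
      (fun x : X => g • x) '' RelCWComplex.openCell n i = RelCWComplex.openCell n j
  smul_eq_self (g : G) (n : ℕ) (i : RelCWComplex.cell (Set.univ : Set X) n)
    (h : (fun x : X => g • x) '' RelCWComplex.openCell n i = RelCWComplex.openCell n i)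
    (x : X) (hx : x ∈ RelCWComplex.openCell n i) : g • x = x

open Topology in
/-- The class of all groups `G` that admit a finite-dimensional contractible `G`-complex all of
whose stabilizers belong to `𝔛`. -/
def actsWithStabilizersIn (𝔛 : GroupClass.{u}) : GroupClass.{u} := fun G _ =>
  ∃ (X : Type u) (_ : TopologicalSpace X) (_ : MulAction G X)
    (_ : CWComplex (Set.univ : Set X)),
    IsGComplex G X ∧ RelCWComplex.FiniteDimensional (Set.univ : Set X) ∧ ContractibleSpace X ∧
      ∀ x : X, 𝔛 (MulAction.stabilizer G x)

/-- The hierarchy `H_α 𝔛`, by transfinite recursion: `H_0 𝔛 = 𝔛`; `H_{α+1} 𝔛` is the class of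
groups with a finite-dimensional contractible `G`-complex with stabilizers in `H_α 𝔛`; and
`H_α 𝔛` is the union of the `H_β 𝔛` with `β < α` if `α` is a nonzero limit ordinal. -/
noncomputable def hierarchy (𝔛 : GroupClass.{u}) (α : Ordinal.{u}) : GroupClass.{u} :=
  Ordinal.limitRecOn (motive := fun _ => GroupClass.{u}) α 𝔛
    (fun _ H => actsWithStabilizersIn H)
    (fun α _ H => fun G _ => ∃ (β : Ordinal.{u}) (hβ : β < α), H β hβ G)

theorem hierarchy_zero (𝔛 : GroupClass.{u}) : hierarchy 𝔛 0 = 𝔛 :=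
  Ordinal.limitRecOn_zero ..

theorem hierarchy_succ (𝔛 : GroupClass.{u}) (α : Ordinal.{u}) :
    hierarchy 𝔛 (α + 1) = actsWithStabilizersIn (hierarchy 𝔛 α) :=
  Ordinal.limitRecOn_add_one ..

theorem hierarchy_limit (𝔛 : GroupClass.{u}) (α : Ordinal.{u}) (hα : Order.IsSuccLimit α) :
    hierarchy 𝔛 α = fun (G : Type u) (_ : Group G) => ∃ β < α, hierarchy 𝔛 β G := by
  unfold hierarchy
  rw [Ordinal.limitRecOn_limit (h := hα)]
  simp only [exists_prop]

/-- The derived length of a soluble group `G`: the least `n` such that the `n`-th term of the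
derived series `G = G⁽⁰⁾ ≥ G⁽¹⁾ = [G, G] ≥ ⋯` is trivial. -/
noncomputable def derivedLength (G : Type u) [Group G] [Group.IsSolvable G] : ℕ :=
  sInf {n : ℕ | derivedSeries G n = ⊥}

/-! The induction runs on virtually free abelian groups of finite rank instead of finite groups:
these lie one level above the finite groups, so it suffices that a finitely generated `G` with
`derivedSeries G (n + 1) = ⊥` lies in `virtuallyFreeAbelianHierarchy n`. Adding one more abelian
layer must therefore cost only one level, although the kernel of the quotient map need not be
finitely generated. This is `virtuallyFreeAbelianHierarchy_of_hom`: a complex for the quotient pulls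
back to `G`, which reduces the question to stabilizers and finally to a countable group with abelian
kernel over a virtually free abelian quotient.

In that case a finite-index subgroup `H` maps onto `ℤ ^ r` with countable abelian kernel `N`. Write
`N` as an ascending union of finitely generated subgroups `A m`, and lift the basis of `ℤ ^ r` to
elements `t i` whose conjugation carries `A m` into `A (m + 1)` and whose commutators lie in every
`A m`. Then right multiplication by the `t i`, together with the passage from `A m` to `A (m + 1)`,
gives `r + 1` commuting maps on the union of the sets `H ⧸ A m`. The mapping telescope of this free,
directed action of `ℕ ^ (r + 1)` is contractible, of dimension at most `r + 1`, and its stabilizers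
in `H` lie in conjugates of the `A m`. It absorbs the quotient `ℤ ^ r` and the infinitely generated
kernel in one step (`actsWithStabilizersIn_of_surjective`).

Coinduction extends the action from `H` to `G`. It permutes the telescope directions, so the cubes
are cut into simplices by the order of their coordinates; an element preserving such a simplex fixes
it pointwise. -/

open scoped NNReal

/-! ### The mapping telescope of an action of `ℕ ^ S`: topology and separation -/

section Telescope

variable {S V : Type u}

/-- The coordinatewise integral part of a vector. -/
noncomputable def floorVec (t : S → ℝ≥0) : S → ℕ := fun i => ⌊t i⌋₊

/-- The coordinatewise fractional part of a vector. -/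
noncomputable def fractVec (t : S → ℝ≥0) : S → ℝ≥0 := fun i => t i - ⌊t i⌋₊

/-- A vector of natural numbers, seen as a vector of nonnegative reals. -/
def natVec (k : S → ℕ) : S → ℝ≥0 := fun i => k i

theorem natVec_floorVec_add_fractVec (t : S → ℝ≥0) : natVec (floorVec t) + fractVec t = t := by
  funext i
  exact add_tsub_cancel_of_le (Nat.floor_le (zero_le))

theorem fractVec_lt_one (t : S → ℝ≥0) (i : S) : fractVec t i < 1 := by
  have h := Nat.lt_floor_add_one (t i)
  have h' : (⌊t i⌋₊ : ℝ≥0) ≤ t i := Nat.floor_le (zero_le)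
  exact (tsub_lt_iff_left h').2 h

theorem floorVec_natVec_add (k : S → ℕ) (t : S → ℝ≥0) :
    floorVec (natVec k + t) = k + floorVec t := by
  funext i
  simp only [floorVec, natVec, Pi.add_apply]
  rw [add_comm, Nat.floor_add_natCast (zero_le), add_comm]

theorem fractVec_natVec_add (k : S → ℕ) (t : S → ℝ≥0) :
    fractVec (natVec k + t) = fractVec t := by
  funext i
  have h := congrFun (floorVec_natVec_add k t) i
  simp only [floorVec, Pi.add_apply] at h
  simp only [fractVec, Pi.add_apply]
  rw [h, natVec]
  push_cast
  exact add_tsub_add_eq_tsub_left _ _ _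

theorem floorVec_eq_zero {t : S → ℝ≥0} (h : ∀ i, t i < 1) : floorVec t = 0 := by
  funext i
  exact Nat.floor_eq_zero.2 (h i)

theorem fractVec_eq_self {t : S → ℝ≥0} (h : ∀ i, t i < 1) : fractVec t = t := by
  funext i
  have := congrFun (floorVec_eq_zero h) i
  simp only [floorVec, Pi.zero_apply] at this
  simp [fractVec, this]

variable [AddAction (S → ℕ) V]

variable (S V) in
/-- Two pairs `(v, t)` and `(w, s)` are identified if they become equal after the integral part of
the vector has been moved into the vertex. -/
noncomputable def telescopeSetoid : Setoid (Σ _ : V, (S → ℝ≥0)) :=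
  Setoid.ker fun p => (floorVec p.2 +ᵥ p.1, fractVec p.2)

variable (S V) in
/-- The multi-dimensional mapping telescope of a set `V` with an action of `ℕ ^ S`: it is
obtained from the disjoint union of the orthants `{v} × [0, ∞) ^ S` by identifying `(v, k + t)` and
`(k +ᵥ v, t)` for all `k : S → ℕ`. -/
def Telescope : Type u := Quotient (telescopeSetoid S V)

instance : TopologicalSpace (Telescope S V) :=
  inferInstanceAs (TopologicalSpace (Quotient (telescopeSetoid S V)))

namespace Telescope

/-- The chart of the telescope at the vertex `v`. -/
noncomputable def mk (v : V) (t : S → ℝ≥0) : Telescope S V :=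
  Quotient.mk (telescopeSetoid S V) ⟨v, t⟩

theorem mk_eq_mk {v w : V} {t s : S → ℝ≥0} :
    mk v t = mk w s ↔ floorVec t +ᵥ v = floorVec s +ᵥ w ∧ fractVec t = fractVec s := by
  refine Quotient.eq.trans ?_
  change (_, _) = (_, _) ↔ _
  rw [Prod.mk.injEq]

theorem mk_surjective (x : Telescope S V) : ∃ v t, x = mk v t := by
  obtain ⟨⟨v, t⟩, rfl⟩ := Quotient.exists_rep x
  exact ⟨v, t, rfl⟩

theorem mk_natVec_add (v : V) (k : S → ℕ) (t : S → ℝ≥0) :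
    mk v (natVec k + t) = mk (k +ᵥ v) t := by
  rw [mk_eq_mk, floorVec_natVec_add, fractVec_natVec_add, vadd_vadd, add_comm]
  exact ⟨rfl, rfl⟩

theorem exists_eq_mk_lt_one (x : Telescope S V) : ∃ v t, (∀ i, t i < 1) ∧ x = mk v t := by
  obtain ⟨v, t, rfl⟩ := mk_surjective x
  exact ⟨floorVec t +ᵥ v, fractVec t, fractVec_lt_one t,
    by rw [← mk_natVec_add, natVec_floorVec_add_fractVec]⟩

theorem mk_eq_mk_of_lt_one {v w : V} {t s : S → ℝ≥0} (ht : ∀ i, t i < 1) (hs : ∀ i, s i < 1) :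
    mk v t = mk w s ↔ v = w ∧ t = s := by
  rw [mk_eq_mk, floorVec_eq_zero ht, floorVec_eq_zero hs, fractVec_eq_self ht,
    fractVec_eq_self hs, zero_vadd, zero_vadd]

theorem isQuotientMap_mk :
    Topology.IsQuotientMap fun p : Σ _ : V, (S → ℝ≥0) => (mk p.1 p.2 : Telescope S V) :=
  isQuotientMap_quotient_mk'

theorem continuous_mk (v : V) : Continuous (mk v : (S → ℝ≥0) → Telescope S V) :=
  isQuotientMap_mk.continuous.comp continuous_sigmaMk

theorem continuous_iff {Y : Type*} [TopologicalSpace Y] {f : Telescope S V → Y} :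
    Continuous f ↔ ∀ v, Continuous fun t => f (mk v t) := by
  rw [isQuotientMap_mk.continuous_iff, continuous_sigma_iff]
  rfl

theorem isOpen_iff {U : Set (Telescope S V)} : IsOpen U ↔ ∀ v, IsOpen (mk v ⁻¹' U) := by
  rw [← isQuotientMap_mk.isOpen_preimage, isOpen_sigma_iff]
  rfl

theorem isClosed_iff {U : Set (Telescope S V)} : IsClosed U ↔ ∀ v, IsClosed (mk v ⁻¹' U) := by
  simp only [← isOpen_compl_iff, isOpen_iff, Set.preimage_compl]

/-- The product of a quotient map with a locally compact space is again a quotient map. With `Y` the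
unit interval this lets homotopies be checked chart by chart. -/
theorem continuous_prod {Y Z : Type*} [TopologicalSpace Y] [TopologicalSpace Z]
    [LocallyCompactSpace Y] {f : Telescope S V × Y → Z}
    (h : ∀ v, Continuous fun p : (S → ℝ≥0) × Y => f (mk v p.1, p.2)) : Continuous f := by
  refine isQuotientMap_mk.continuous_lift_prod_left ?_
  rw [← (Homeomorph.sigmaProdDistrib (X := fun _ : V => S → ℝ≥0) (Y := Y)).symm.comp_continuous_iff']
  rw [continuous_sigma_iff]
  exact h

/-- The semiflow of `[0, ∞) ^ S` on the telescope. -/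
noncomputable def shift (s : S → ℝ≥0) : Telescope S V → Telescope S V :=
  Quotient.lift (fun p => mk p.1 (s + p.2)) <| by
    rintro ⟨v, t⟩ ⟨w, t'⟩ h
    obtain ⟨h₁, h₂⟩ := mk_eq_mk.1 (Quotient.sound h : mk v t = mk w t')
    change mk v (s + t) = mk w (s + t')
    rw [← natVec_floorVec_add_fractVec t, ← natVec_floorVec_add_fractVec t', add_left_comm,
      mk_natVec_add, add_left_comm, mk_natVec_add, h₁, h₂]

theorem shift_mk (s t : S → ℝ≥0) (v : V) : shift s (mk v t) = mk v (s + t) := rfl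

theorem shift_shift (s t : S → ℝ≥0) (x : Telescope S V) :
    shift s (shift t x) = shift (s + t) x := by
  obtain ⟨v, r, rfl⟩ := mk_surjective x
  simp only [shift_mk, add_assoc]

theorem shift_zero (x : Telescope S V) : shift 0 x = x := by
  obtain ⟨v, r, rfl⟩ := mk_surjective x
  simp only [shift_mk, zero_add]

/-- The points whose forward orbit meets the forward orbit of `x` within time less than `ε`. -/
def nearby (x : Telescope S V) (ε : ℝ≥0) : Set (Telescope S V) :=
  {z | ∃ s s' : S → ℝ≥0, (∀ i, s i < ε) ∧ (∀ i, s' i < ε) ∧ shift s x = shift s' z}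

theorem mem_nearby_self (x : Telescope S V) {ε : ℝ≥0} (hε : 0 < ε) : x ∈ nearby x ε :=
  ⟨0, 0, fun _ => hε, fun _ => hε, rfl⟩

/-- Two points `t` and `r` of one chart both flow to their coordinatewise maximum, in times given by
the truncated differences, and these are small when `r` is near `t`. -/
theorem isOpen_nearby [Finite S] (x : Telescope S V) (ε : ℝ≥0) : IsOpen (nearby x ε) := by
  rw [isOpen_iff]
  intro v
  rw [isOpen_iff_mem_nhds]
  rintro t ⟨s, s', hs, hs', h⟩
  have h₁ : ∀ᶠ r : S → ℝ≥0 in nhds t, ∀ i, s i + (r i - t i) < ε := by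
    rw [Filter.eventually_all]
    intro i
    have hc : Continuous fun r : S → ℝ≥0 => s i + (r i - t i) := by fun_prop
    exact hc.continuousAt.eventually_lt_const (by simpa using hs i)
  have h₂ : ∀ᶠ r : S → ℝ≥0 in nhds t, ∀ i, s' i + (t i - r i) < ε := by
    rw [Filter.eventually_all]
    intro i
    have hc : Continuous fun r : S → ℝ≥0 => s' i + (t i - r i) := by fun_prop
    exact hc.continuousAt.eventually_lt_const (by simpa using hs' i)
  filter_upwards [h₁, h₂] with r hr₁ hr₂
  refine ⟨s + (r - t), s' + (t - r), hr₁, hr₂, ?_⟩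
  rw [add_comm s, ← shift_shift, h, shift_mk, shift_mk, shift_mk]
  congr 1
  rw [add_left_comm, add_assoc]
  congr 1
  funext i
  simp only [Pi.add_apply, Pi.sub_apply, tsub_add_eq_max, max_comm]

/-- For small `ε` the flow keeps both points in their half-open cubes, where vertex and coordinates
are unique. Merging within every such `ε` would force equal vertices and coordinates differing by at
most `ε`, hence equality. -/
theorem exists_not_nearby [Finite S] {x y : Telescope S V} (hxy : x ≠ y) :
    ∃ ε > 0, ∀ s s' : S → ℝ≥0, (∀ i, s i < ε) → (∀ i, s' i < ε) → shift s x ≠ shift s' y := by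
  obtain ⟨v, t, ht, rfl⟩ := exists_eq_mk_lt_one x
  obtain ⟨w, r, hr, rfl⟩ := exists_eq_mk_lt_one y
  by_contra! hcon
  have hsmall : ∀ t : S → ℝ≥0, (∀ i, t i < 1) → ∀ᶠ ε : ℝ≥0 in nhds 0, ∀ i, ε + t i < 1 := by
    intro t ht
    rw [Filter.eventually_all]
    intro i
    have hc : Continuous fun ε : ℝ≥0 => ε + t i := by fun_prop
    exact hc.continuousAt.eventually_lt_const (by simpa using ht i)
  have key : ∀ᶠ ε : ℝ≥0 in nhdsWithin 0 (Set.Ioi 0), v = w ∧ ∀ i, t i ≤ r i + ε ∧ r i ≤ t i + ε := by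
    filter_upwards [nhdsWithin_le_nhds (hsmall t ht), nhdsWithin_le_nhds (hsmall r hr),
      self_mem_nhdsWithin] with ε h₁ h₂ h₃
    obtain ⟨s, s', hs, hs', h⟩ := hcon ε h₃
    rw [shift_mk, shift_mk, mk_eq_mk_of_lt_one] at h
    · refine ⟨h.1, fun i => ?_⟩
      have hi : s i + t i = s' i + r i := congrFun h.2 i
      constructor
      · calc t i ≤ s i + t i := le_add_self
          _ = r i + s' i := by rw [hi, add_comm]
          _ ≤ r i + ε := by gcongr; exact (hs' i).le
      · calc r i ≤ s' i + r i := le_add_self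
          _ = t i + s i := by rw [← hi, add_comm]
          _ ≤ t i + ε := by gcongr; exact (hs i).le
    · exact fun i => (add_le_add_left (hs i).le _).trans_lt (h₁ i)
    · exact fun i => (add_le_add_left (hs' i).le _).trans_lt (h₂ i)
  have hvw : v = w := key.exists.choose_spec.1
  refine hxy ?_
  rw [hvw]
  congr 1
  funext i
  have lim : ∀ a : ℝ≥0, Filter.Tendsto (fun ε : ℝ≥0 => a + ε) (nhdsWithin 0 (Set.Ioi 0))
      (nhds a) := fun a => by
    have hc : Continuous fun ε : ℝ≥0 => a + ε := by fun_prop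
    simpa using (hc.tendsto 0).mono_left nhdsWithin_le_nhds
  exact le_antisymm (ge_of_tendsto (lim _) (key.mono fun ε h => (h.2 i).1))
    (ge_of_tendsto (lim _) (key.mono fun ε h => (h.2 i).2))

instance [Finite S] : T2Space (Telescope S V) := by
  refine ⟨fun x y hxy => ?_⟩
  obtain ⟨ε, hε, h⟩ := exists_not_nearby hxy
  -- Through a common nearby point the two merging times add up, so half of `ε` is enough.
  refine ⟨nearby x (ε / 2), nearby y (ε / 2), isOpen_nearby _ _, isOpen_nearby _ _,
    mem_nearby_self x (half_pos hε), mem_nearby_self y (half_pos hε), ?_⟩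
  rw [Set.disjoint_left]
  rintro z ⟨s, s', hs, hs', h₁⟩ ⟨r, r', hr, hr', h₂⟩
  refine h (r' + s) (s' + r) (fun i => ?_) (fun i => ?_) ?_
  · exact (add_lt_add (hr' i) (hs i)).trans_eq (add_halves ε)
  · exact (add_lt_add (hs' i) (hr i)).trans_eq (add_halves ε)
  · rw [← shift_shift, h₁, ← shift_shift, h₂, shift_shift, shift_shift, add_comm]

end Telescope
end Telescope

/-! ### Contractibility of the telescope -/

namespace Telescope

variable {S V : Type u} [AddAction (S → ℕ) V]

theorem shift_left_injective (hfree : ∀ (v : V) (a b : S → ℕ), a +ᵥ v = b +ᵥ v → a = b)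
    (x : Telescope S V) : Function.Injective fun s => shift s x := by
  intro s s' h
  obtain ⟨v, t, rfl⟩ := mk_surjective x
  obtain ⟨h₁, h₂⟩ := mk_eq_mk.1 h
  have h₃ := hfree _ _ _ h₁
  refine add_right_cancel (b := t) ?_
  rw [← natVec_floorVec_add_fractVec (s + t), h₃, h₂, natVec_floorVec_add_fractVec]

/-- The diagonal ray from the vertex `v₀`. -/
noncomputable def ray (v₀ : V) (m : ℝ≥0) : Telescope S V := mk v₀ fun _ => m

theorem continuous_ray (v₀ : V) : Continuous (ray v₀ : ℝ≥0 → Telescope S V) :=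
  (continuous_mk v₀).comp (by fun_prop)

theorem shift_ray (v₀ : V) (c m : ℝ≥0) :
    shift (fun _ => c) (ray v₀ m : Telescope S V) = ray v₀ (c + m) := rfl

/-- The times `m` such that `x` flows to the point `m` of the diagonal ray from `v₀`. -/
def mergeTimes (v₀ : V) (x : Telescope S V) : Set ℝ≥0 := {m | ∃ s, shift s x = ray v₀ m}

theorem mergeTimes_mono {v₀ : V} {x : Telescope S V} {m m' : ℝ≥0} (h : m ∈ mergeTimes v₀ x)
    (hm : m ≤ m') : m' ∈ mergeTimes v₀ x := by
  obtain ⟨s, hs⟩ := h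
  refine ⟨(fun _ => m' - m) + s, ?_⟩
  rw [← shift_shift, hs, shift_ray, tsub_add_cancel_of_le hm]

theorem mergeTimes_nonempty [Finite S] (hdir : ∀ v w : V, ∃ a b : S → ℕ, a +ᵥ v = b +ᵥ w)
    (v₀ : V) (x : Telescope S V) : (mergeTimes v₀ x).Nonempty := by
  obtain ⟨v, t, ht, rfl⟩ := exists_eq_mk_lt_one x
  obtain ⟨a, b, hab⟩ := hdir v v₀
  obtain ⟨c, hc⟩ : ∃ c, ∀ i, b i ≤ c := by
    cases nonempty_fintype S
    exact ⟨∑ i, b i, fun i => Finset.single_le_sum (fun _ _ => Nat.zero_le _) (Finset.mem_univ i)⟩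
  -- Adding `e` to `b` gives the constant vector `c + 1`, which lies on the diagonal; the extra `1`
  -- makes every coordinate of `e + a` at least `1`, so that `t` can be subtracted.
  let e : S → ℕ := fun i => c + 1 - b i
  refine ⟨(c + 1 : ℕ), natVec (e + a) - t, ?_⟩
  rw [shift_mk, tsub_add_cancel_of_le, ← add_zero (natVec _), mk_natVec_add, add_vadd, hab,
    vadd_vadd, ← mk_natVec_add, add_zero]
  · rw [ray]
    congr 1
    funext i
    simp only [natVec, e, Pi.add_apply]
    rw [Nat.sub_add_cancel ((hc i).trans (Nat.le_succ c))]
  · intro i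
    refine (ht i).le.trans ?_
    simp only [natVec, e, Pi.add_apply]
    have := hc i
    exact_mod_cast (by omega : 1 ≤ c + 1 - b i + a i)

/-- The infimum of the times at which `x` has merged with the diagonal ray from `v₀`. -/
noncomputable def mergeTime (v₀ : V) (x : Telescope S V) : ℝ≥0 := sInf (mergeTimes v₀ x)

section

variable [Fintype S]

theorem mergeTime_le_shift (hdir : ∀ v w : V, ∃ a b : S → ℕ, a +ᵥ v = b +ᵥ w) (v₀ : V)
    (s : S → ℝ≥0) (x : Telescope S V) :
    mergeTime v₀ x ≤ mergeTime v₀ (shift s x) := by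
  refine csInf_le_csInf (OrderBot.bddBelow _) (mergeTimes_nonempty hdir _ _) ?_
  rintro m ⟨r, hr⟩
  exact ⟨r + s, by rw [← shift_shift, hr]⟩

theorem mergeTime_shift_le (hdir : ∀ v w : V, ∃ a b : S → ℕ, a +ᵥ v = b +ᵥ w) (v₀ : V)
    {s : S → ℝ≥0} {c : ℝ≥0} (hs : ∀ i, s i ≤ c)
    (x : Telescope S V) : mergeTime v₀ (shift s x) ≤ mergeTime v₀ x + c := by
  rw [← tsub_le_iff_right]
  refine le_csInf (mergeTimes_nonempty hdir _ _) ?_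
  rintro m ⟨r, hr⟩
  rw [tsub_le_iff_left]
  refine csInf_le (OrderBot.bddBelow _) ⟨((fun _ => c) - s) + r, ?_⟩
  rw [shift_shift, add_right_comm, tsub_add_cancel_of_le (fun i => hs i), ← shift_shift, hr,
    shift_ray]

/-- On each chart `mergeTime` is 1-Lipschitz for the sup metric: `t` and `t'` both flow to their
coordinatewise maximum, and the flow never lowers `mergeTime` and raises it by at most the largest
coordinate of the time. -/
theorem continuous_mergeTime (hdir : ∀ v w : V, ∃ a b : S → ℕ, a +ᵥ v = b +ᵥ w) (v₀ : V) :
    Continuous (mergeTime v₀ : Telescope S V → ℝ≥0) := by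
  rw [continuous_iff]
  intro v
  refine LipschitzWith.continuous (K := 1) (LipschitzWith.of_edist_le fun t t' => ?_)
  rw [edist_nndist, edist_nndist, ENNReal.coe_le_coe]
  have key : ∀ t t' : S → ℝ≥0, mergeTime v₀ (mk v t : Telescope S V) ≤
      mergeTime v₀ (mk v t' : Telescope S V) + nndist t t' := by
    intro t t'
    refine (mergeTime_le_shift hdir v₀ (t' - t) _).trans ?_
    have h : shift (t' - t) (mk v t : Telescope S V) = shift (t - t') (mk v t') := by
      rw [shift_mk, shift_mk]
      congr 1
      funext i
      simp only [Pi.add_apply, Pi.sub_apply, tsub_add_eq_max, max_comm]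
    rw [h]
    refine mergeTime_shift_le hdir v₀ (fun i => ?_) _
    rw [Pi.sub_apply, tsub_le_iff_left]
    exact (NNReal.le_add_nndist _ _).trans (by gcongr; exact nndist_le_pi_nndist t t' i)
  have h₁ := key t t'
  have h₂ := key t' t
  rw [nndist_comm] at h₂
  rw [← NNReal.coe_le_coe] at h₁ h₂ ⊢
  push_cast at h₁ h₂ ⊢
  rw [NNReal.dist_eq, abs_le]
  constructor <;> linarith

/-- The infimum need not be attained, but `mergeTimes` is upward closed, so a constant margin yields
a merging time that still depends continuously on the point. -/
theorem mergeTime_add_one_mem (hdir : ∀ v w : V, ∃ a b : S → ℕ, a +ᵥ v = b +ᵥ w)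
    (v₀ : V) (x : Telescope S V) :
    mergeTime v₀ x + 1 ∈ mergeTimes v₀ x := by
  obtain ⟨m, hm, hlt⟩ := exists_lt_of_csInf_lt (mergeTimes_nonempty hdir v₀ x)
    (lt_add_one (mergeTime v₀ x))
  exact mergeTimes_mono hm hlt.le

/-- By freeness the flow time is determined by its endpoint. Comparing with the origin of the same
chart expresses the chosen time as `mergeTime` minus the coordinate plus a constant, so the choice
is automatically continuous. -/
theorem exists_continuous_shift_eq_ray (hdir : ∀ v w : V, ∃ a b : S → ℕ, a +ᵥ v = b +ᵥ w)
    (hfree : ∀ (v : V) (a b : S → ℕ), a +ᵥ v = b +ᵥ v → a = b) (v₀ : V) :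
    ∃ σ : Telescope S V → S → ℝ≥0, Continuous σ ∧
      ∀ x, shift (σ x) x = ray v₀ (mergeTime v₀ x + 1) := by
  choose σ hσ using mergeTime_add_one_mem hdir v₀
  refine ⟨σ, ?_, hσ⟩
  rw [continuous_iff]
  intro v
  refine continuous_pi fun i => ?_
  rw [NNReal.isEmbedding_coe.continuous_iff]
  have key : ∀ t, (σ (mk v t) i : ℝ) =
      mergeTime v₀ (mk v t : Telescope S V) + σ (mk v 0) i
        - mergeTime v₀ (mk v 0 : Telescope S V) - t i := by
    intro t
    -- Each point is pushed further along the ray by the time of the other, so that both arrive at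
    -- the same point.
    have h₁ := congrArg (shift fun _ => mergeTime v₀ (mk v 0 : Telescope S V) + 1) (hσ (mk v t))
    have h₂ := congrArg (shift fun _ => mergeTime v₀ (mk v t : Telescope S V) + 1) (hσ (mk v 0))
    rw [shift_ray, shift_mk, shift_mk] at h₁ h₂
    rw [add_comm (mergeTime v₀ (mk v 0) + 1), ← h₂] at h₁
    have h₃ := shift_left_injective hfree (mk v 0)
      (a₁ := (fun _ => mergeTime v₀ (mk v 0 : Telescope S V) + 1) + (σ (mk v t) + t))
      (a₂ := (fun _ => mergeTime v₀ (mk v t : Telescope S V) + 1) + (σ (mk v 0) + 0))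
      (by simpa only [shift_mk, add_zero] using h₁)
    have h₄ := congrArg ((↑) : ℝ≥0 → ℝ) (congrFun h₃ i)
    simp only [Pi.add_apply, NNReal.coe_add, NNReal.coe_one, Pi.zero_apply, NNReal.coe_zero] at h₄
    linarith
  have hc := (continuous_mergeTime hdir v₀).comp (continuous_mk v)
  refine Continuous.congr ?_ fun t => (key t).symm
  have hc' : Continuous fun t => (mergeTime v₀ (mk v t : Telescope S V) : ℝ) :=
    NNReal.continuous_coe.comp hc
  fun_prop

/-- Flowing for the fraction `p` of the time `σ` deforms the identity into a map to the diagonal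
ray, which then shrinks to its origin. -/
theorem contractibleSpace [Nonempty V] (hdir : ∀ v w : V, ∃ a b : S → ℕ, a +ᵥ v = b +ᵥ w)
    (hfree : ∀ (v : V) (a b : S → ℕ), a +ᵥ v = b +ᵥ v → a = b) :
    ContractibleSpace (Telescope S V) := by
  obtain ⟨v₀⟩ := ‹Nonempty V›
  obtain ⟨σ, hσ, h⟩ := exists_continuous_shift_eq_ray hdir hfree v₀
  have hm : Continuous fun x : Telescope S V => mergeTime v₀ x + 1 :=
    (continuous_mergeTime hdir v₀).add continuous_const
  have hI : Continuous unitInterval.toNNReal := by fun_prop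
  let g : C(Telescope S V, Telescope S V) := ⟨_, (continuous_ray v₀).comp hm⟩
  rw [contractible_iff_id_nullhomotopic]
  refine ⟨ray v₀ 0, ContinuousMap.Homotopic.trans (g := g) ⟨⟨⟨fun p =>
    shift (fun i => unitInterval.toNNReal p.1 * σ p.2 i) p.2, ?_⟩, fun x => ?_, fun x => ?_⟩⟩
    (ContinuousMap.Homotopic.symm ⟨⟨⟨fun p =>
    ray v₀ (unitInterval.toNNReal p.1 * (mergeTime v₀ p.2 + 1)), ?_⟩, fun x => ?_, fun x => ?_⟩⟩)⟩
  · refine Continuous.comp (g := fun p : Telescope S V × unitInterval =>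
      shift (fun i => unitInterval.toNNReal p.2 * σ p.1 i) p.1) (continuous_prod fun v => ?_)
      continuous_swap
    simp only [shift_mk]
    refine (continuous_mk v).comp (continuous_pi fun i => ?_)
    have hσv : Continuous fun t => σ (mk v t) i :=
      (continuous_apply i).comp (hσ.comp (continuous_mk v))
    have hσv' := hσv.comp (continuous_fst (X := S → ℝ≥0) (Y := unitInterval))
    simp only [Pi.add_apply]
    exact ((hI.comp continuous_snd).mul hσv').add ((continuous_apply i).comp continuous_fst)
  · simp only [unitInterval.toNNReal_zero, zero_mul]
    exact shift_zero x
  · simp only [unitInterval.toNNReal_one, one_mul]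
    exact h x
  · exact (continuous_ray v₀).comp ((hI.comp continuous_fst).mul (hm.comp continuous_snd))
  · simp
  · simp [g]

end

end Telescope

/-! ### Ordered simplices and their identification with balls -/

section Simplex

/-- The open simplex `0 < u 0 < ⋯ < u (n - 1) < 1`. -/
def openSimplex (n : ℕ) : Set (Fin n → ℝ) :=
  {u | StrictMono (Fin.cons 0 u : Fin (n + 1) → ℝ) ∧ ∀ i, u i < 1}

/-- The closed simplex `0 ≤ u 0 ≤ ⋯ ≤ u (n - 1) ≤ 1`. -/
def closedSimplex (n : ℕ) : Set (Fin n → ℝ) :=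
  {u | Monotone (Fin.cons 0 u : Fin (n + 1) → ℝ) ∧ ∀ i, u i ≤ 1}

theorem continuous_cons_zero {n : ℕ} (j : Fin (n + 1)) :
    Continuous fun u : Fin n → ℝ => (Fin.cons 0 u : Fin (n + 1) → ℝ) j := by
  induction j using Fin.cases with
  | zero => simpa using continuous_const
  | succ j => simpa using continuous_apply j

theorem cons_zero_combo {n : ℕ} (a b : ℝ) (u w : Fin n → ℝ) (j : Fin (n + 1)) :
    (Fin.cons 0 (a • u + b • w) : Fin (n + 1) → ℝ) j =
      a * (Fin.cons 0 u : Fin (n + 1) → ℝ) j + b * (Fin.cons 0 w : Fin (n + 1) → ℝ) j := by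
  induction j using Fin.cases with
  | zero => simp
  | succ j => simp

/-- A positive share of strict inequalities makes weak ones strict. This gives both convexity and
the closure of the open simplex. -/
theorem combo_mem_openSimplex {n : ℕ} {a b : ℝ} (ha : 0 ≤ a) (hb : 0 < b) (hab : a + b = 1)
    {u w : Fin n → ℝ} (hu : u ∈ closedSimplex n) (hw : w ∈ openSimplex n) :
    a • u + b • w ∈ openSimplex n := by
  refine ⟨fun i j hij => ?_, fun i => ?_⟩
  · rw [cons_zero_combo, cons_zero_combo]
    exact add_lt_add_of_le_of_lt (mul_le_mul_of_nonneg_left (hu.1 hij.le) ha)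
      (mul_lt_mul_of_pos_left (hw.1 hij) hb)
  · have h₁ := mul_le_mul_of_nonneg_left (hu.2 i) ha
    have h₂ := mul_lt_mul_of_pos_left (hw.2 i) hb
    simp only [Pi.add_apply, Pi.smul_apply, smul_eq_mul]
    linarith

theorem openSimplex_subset_closedSimplex (n : ℕ) : openSimplex n ⊆ closedSimplex n :=
  fun _ hu => ⟨hu.1.monotone, fun i => (hu.2 i).le⟩

theorem convex_openSimplex (n : ℕ) : Convex ℝ (openSimplex n) := by
  intro u hu w hw a b ha hb hab
  rcases hb.eq_or_lt with rfl | hb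
  · obtain rfl : a = 1 := by linarith
    simpa using hu
  · exact combo_mem_openSimplex ha hb hab (openSimplex_subset_closedSimplex n hu) hw

theorem isOpen_openSimplex (n : ℕ) : IsOpen (openSimplex n) := by
  have : openSimplex n = (⋂ i : Fin n, {u | (Fin.cons 0 u : Fin (n + 1) → ℝ) i.castSucc <
      (Fin.cons 0 u : Fin (n + 1) → ℝ) i.succ}) ∩ ⋂ i : Fin n, {u | u i < 1} := by
    ext u
    simp [openSimplex, Fin.strictMono_iff_lt_succ]
  rw [this]
  exact (isOpen_iInter_of_finite fun i =>
    isOpen_lt (continuous_cons_zero _) (continuous_cons_zero _)).inter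
    (isOpen_iInter_of_finite fun i => isOpen_lt (continuous_apply i) continuous_const)

theorem isClosed_closedSimplex (n : ℕ) : IsClosed (closedSimplex n) := by
  have : closedSimplex n = (⋂ i : Fin n, {u | (Fin.cons 0 u : Fin (n + 1) → ℝ) i.castSucc ≤
      (Fin.cons 0 u : Fin (n + 1) → ℝ) i.succ}) ∩ ⋂ i : Fin n, {u | u i ≤ 1} := by
    ext u
    simp [closedSimplex, Fin.monotone_iff_le_succ]
  rw [this]
  exact (isClosed_iInter fun i =>
    isClosed_le (continuous_cons_zero _) (continuous_cons_zero _)).inter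
    (isClosed_iInter fun i => isClosed_le (continuous_apply i) continuous_const)

theorem cons_zero_mem_Icc {n : ℕ} {u : Fin n → ℝ} (hu : u ∈ closedSimplex n) (j : Fin (n + 1)) :
    (Fin.cons 0 u : Fin (n + 1) → ℝ) j ∈ Set.Icc (0 : ℝ) 1 := by
  refine ⟨by simpa using hu.1 (Fin.zero_le j), ?_⟩
  induction j using Fin.cases with
  | zero => simp
  | succ j => simpa using hu.2 j

theorem isBounded_closedSimplex (n : ℕ) : Bornology.IsBounded (closedSimplex n) := by
  refine (Metric.isBounded_Icc (0 : Fin n → ℝ) 1).subset fun u hu => ?_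
  exact ⟨fun i => by simpa using (cons_zero_mem_Icc hu i.succ).1, hu.2⟩

theorem openSimplex_nonempty (n : ℕ) : (openSimplex n).Nonempty := by
  have h : (Fin.cons 0 (fun i : Fin n => ((i : ℕ) + 1 : ℝ) / (n + 1)) : Fin (n + 1) → ℝ) =
      fun i : Fin (n + 1) => ((i : ℕ) : ℝ) / (n + 1) := by
    funext i
    induction i using Fin.cases <;> simp
  refine ⟨fun i => ((i : ℕ) + 1 : ℝ) / (n + 1), ?_, fun i => ?_⟩
  · rw [h]
    intro i j hij
    have : (0 : ℝ) < n + 1 := by positivity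
    dsimp only
    gcongr
    exact_mod_cast hij
  · rw [div_lt_one (by positivity)]
    exact_mod_cast Nat.succ_lt_succ i.2

theorem closure_openSimplex (n : ℕ) : closure (openSimplex n) = closedSimplex n := by
  refine (closure_minimal (openSimplex_subset_closedSimplex n)
    (isClosed_closedSimplex n)).antisymm fun u hu => ?_
  obtain ⟨w, hw⟩ := openSimplex_nonempty n
  have hc : Continuous fun b : ℝ => (1 - b) • u + b • w := by fun_prop
  have ht : Filter.Tendsto (fun b : ℝ => (1 - b) • u + b • w) (nhdsWithin 0 (Set.Ioi 0))
      (nhds u) := by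
    simpa using (hc.tendsto 0).mono_left nhdsWithin_le_nhds
  refine mem_closure_of_tendsto ht ?_
  filter_upwards [self_mem_nhdsWithin, Ioo_mem_nhdsGT (zero_lt_one' ℝ)] with b hb hb'
  exact combo_mem_openSimplex (by linarith [hb'.2]) hb (by ring) hu hw

theorem exists_homeomorph_simplex (n : ℕ) : ∃ h : (Fin n → ℝ) ≃ₜ (Fin n → ℝ),
    h '' Metric.ball 0 1 = openSimplex n ∧ h '' Metric.closedBall 0 1 = closedSimplex n := by
  obtain ⟨h, h₁, h₂, -⟩ := exists_homeomorph_image_interior_closure_frontier_eq_unitBall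
    (convex_openSimplex n) (by
      rw [(isOpen_openSimplex n).interior_eq]
      exact openSimplex_nonempty n)
    ((isBounded_closedSimplex n).subset (openSimplex_subset_closedSimplex n))
  rw [(isOpen_openSimplex n).interior_eq] at h₁
  rw [closure_openSimplex] at h₂
  refine ⟨h.symm, ?_, ?_⟩
  · rw [← h₁, ← Set.image_comp]
    simp
  · rw [← h₂, ← Set.image_comp]
    simp

/-- A homeomorphism between the unit ball and the simplex. -/
noncomputable def ballToSimplex (n : ℕ) : (Fin n → ℝ) ≃ₜ (Fin n → ℝ) :=
  (exists_homeomorph_simplex n).choose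

theorem ballToSimplex_ball (n : ℕ) : ballToSimplex n '' Metric.ball 0 1 = openSimplex n :=
  (exists_homeomorph_simplex n).choose_spec.1

theorem ballToSimplex_closedBall (n : ℕ) :
    ballToSimplex n '' Metric.closedBall 0 1 = closedSimplex n :=
  (exists_homeomorph_simplex n).choose_spec.2

end Simplex

/-! ### Decomposition of the half-open cube by the order of the coordinates -/

section WeakOrders

variable {S : Type u}

variable (S) in
/-- The weak orderings of the coordinates in `S` of a point of the half open cube: the coordinates
in the fibre over `0` vanish and there are `n` different nonzero values. -/
def WeakOrder (n : ℕ) : Type u := {c : S → Fin (n + 1) // ∀ j ≠ 0, ∃ i, c i = j}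

/-- The point of the cube with weak ordering `c` and values `u`. -/
noncomputable def cubePoint {n : ℕ} (c : S → Fin (n + 1)) (u : Fin n → ℝ) : S → ℝ≥0 :=
  fun i => Real.toNNReal ((Fin.cons 0 u : Fin (n + 1) → ℝ) (c i))

theorem continuous_cubePoint {n : ℕ} (c : S → Fin (n + 1)) : Continuous (cubePoint c) :=
  continuous_pi fun i => continuous_real_toNNReal.comp (continuous_cons_zero (c i))

theorem coe_cubePoint {n : ℕ} (c : S → Fin (n + 1)) {u : Fin n → ℝ} (hu : u ∈ closedSimplex n)
    (i : S) : (cubePoint c u i : ℝ) = (Fin.cons 0 u : Fin (n + 1) → ℝ) (c i) :=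
  Real.coe_toNNReal _ (cons_zero_mem_Icc hu _).1

theorem cubePoint_le_one {n : ℕ} (c : S → Fin (n + 1)) {u : Fin n → ℝ}
    (hu : u ∈ closedSimplex n) (i : S) : cubePoint c u i ≤ 1 := by
  rw [← NNReal.coe_le_coe, coe_cubePoint c hu]
  exact (cons_zero_mem_Icc hu _).2

theorem cubePoint_lt_one {n : ℕ} (c : S → Fin (n + 1)) {u : Fin n → ℝ}
    (hu : u ∈ openSimplex n) (i : S) : cubePoint c u i < 1 := by
  rw [← NNReal.coe_lt_coe, coe_cubePoint c (openSimplex_subset_closedSimplex n hu)]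
  induction c i using Fin.cases with
  | zero => simp
  | succ j => simpa using hu.2 j

theorem WeakOrder.le_card [Fintype S] {n : ℕ} (c : WeakOrder S n) : n ≤ Fintype.card S := by
  choose f hf using fun j : Fin n => c.2 j.succ (Fin.succ_ne_zero j)
  have hinj : Function.Injective f := fun i j hij => by
    have := (hf i).symm.trans ((congrArg c.1 hij).trans (hf j))
    exact Fin.succ_injective _ this
  simpa using Fintype.card_le_of_injective f hinj

instance [Finite S] (n : ℕ) : Finite (WeakOrder S n) :=
  inferInstanceAs (Finite {c : S → Fin (n + 1) // ∀ j ≠ 0, ∃ i, c i = j})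

instance [Finite S] : Finite (Σ n, WeakOrder S n) := by
  cases nonempty_fintype S
  refine Finite.of_surjective
    (fun p : Σ n : Fin (Fintype.card S + 1), WeakOrder S n => (⟨p.1, p.2⟩ : Σ n, WeakOrder S n)) ?_
  rintro ⟨n, c⟩
  exact ⟨⟨⟨n, Nat.lt_succ_of_le c.le_card⟩, c⟩, rfl⟩

/-- Every value other than the leading `0` occurs as a coordinate of the cube point. Hence the point
determines the set of values, and for open simplices also the dimension, the parameters and the weak
order. -/
theorem range_cons_subset {n m : ℕ} (c : WeakOrder S n) (d : WeakOrder S m) {u : Fin n → ℝ}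
    {w : Fin m → ℝ} (hu : u ∈ closedSimplex n) (hw : w ∈ closedSimplex m)
    (h : cubePoint c.1 u = cubePoint d.1 w) :
    Set.range (Fin.cons 0 u : Fin (n + 1) → ℝ) ⊆ Set.range (Fin.cons 0 w : Fin (m + 1) → ℝ) := by
  rintro _ ⟨j, rfl⟩
  by_cases hj : j = 0
  · exact ⟨0, by simp [hj]⟩
  · obtain ⟨i, rfl⟩ := c.2 j hj
    exact ⟨d.1 i, by rw [← coe_cubePoint c.1 hu, ← coe_cubePoint d.1 hw, h]⟩

theorem range_cons_eq {n m : ℕ} {c : WeakOrder S n} {d : WeakOrder S m} {u : Fin n → ℝ}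
    {w : Fin m → ℝ} (hu : u ∈ openSimplex n) (hw : w ∈ openSimplex m)
    (h : cubePoint c.1 u = cubePoint d.1 w) :
    Set.range (Fin.cons 0 u : Fin (n + 1) → ℝ) = Set.range (Fin.cons 0 w : Fin (m + 1) → ℝ) :=
  (range_cons_subset c d (openSimplex_subset_closedSimplex n hu)
    (openSimplex_subset_closedSimplex m hw) h).antisymm
    (range_cons_subset d c (openSimplex_subset_closedSimplex m hw)
    (openSimplex_subset_closedSimplex n hu) h.symm)

theorem dim_eq_of_cubePoint_eq {n m : ℕ} {c : WeakOrder S n} {d : WeakOrder S m} {u : Fin n → ℝ}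
    {w : Fin m → ℝ} (hu : u ∈ openSimplex n) (hw : w ∈ openSimplex m)
    (h : cubePoint c.1 u = cubePoint d.1 w) : n = m := by
  have h₁ := Nat.card_range_of_injective hu.1.injective
  have h₂ := Nat.card_range_of_injective hw.1.injective
  rw [range_cons_eq hu hw h, h₂] at h₁
  simpa using h₁.symm

theorem cubePoint_injective {n : ℕ} {c d : WeakOrder S n} {u w : Fin n → ℝ}
    (hu : u ∈ openSimplex n) (hw : w ∈ openSimplex n)
    (h : cubePoint c.1 u = cubePoint d.1 w) : c = d ∧ u = w := by
  have huw : u = w := Fin.cons_right_injective _ ((hu.1.range_inj hw.1).1 (range_cons_eq hu hw h))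
  subst huw
  refine ⟨Subtype.ext (funext fun i => hu.1.injective ?_), rfl⟩
  have hu' := openSimplex_subset_closedSimplex n hu
  rw [← coe_cubePoint c.1 hu', ← coe_cubePoint d.1 hu', h]

theorem exists_weakOrder [Finite S] (t : S → ℝ≥0) (ht : ∀ i, t i ≤ 1) :
    ∃ (n : ℕ) (c : WeakOrder S n) (u : Fin n → ℝ), u ∈ closedSimplex n ∧
      StrictMono (Fin.cons 0 u : Fin (n + 1) → ℝ) ∧ t = cubePoint c.1 u := by
  classical
  cases nonempty_fintype S
  let E : Finset ℝ≥0 := insert 0 (Finset.univ.image t)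
  obtain ⟨n, hn⟩ : ∃ n, E.card = n + 1 :=
    Nat.exists_eq_add_one.2 (Finset.card_pos.2 (Finset.insert_nonempty _ _))
  let e := E.orderIsoOfFin hn
  have h₀ : (e 0 : ℝ≥0) = 0 := by
    have : e 0 ≤ ⟨0, Finset.mem_insert_self _ _⟩ := by
      rw [← e.apply_symm_apply ⟨0, Finset.mem_insert_self _ _⟩]
      exact e.monotone (Fin.zero_le _)
    exact le_antisymm this zero_le
  have hmem : ∀ i, t i ∈ E := fun i =>
    Finset.mem_insert_of_mem (Finset.mem_image_of_mem t (Finset.mem_univ i))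
  have hcons : (Fin.cons 0 (fun j : Fin n => ((e j.succ : ℝ≥0) : ℝ)) : Fin (n + 1) → ℝ) =
      fun j => ((e j : ℝ≥0) : ℝ) := by
    funext j
    induction j using Fin.cases with
    | zero => simp [h₀]
    | succ j => simp
  have hmono : StrictMono fun j => ((e j : ℝ≥0) : ℝ) := fun i j hij => by
    exact_mod_cast e.strictMono hij
  have hle : ∀ j, (e j : ℝ≥0) ≤ 1 := by
    intro j
    have := (e j).2
    simp only [E, Finset.mem_insert, Finset.mem_image, Finset.mem_univ, true_and] at this
    obtain h | ⟨i, h⟩ := this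
    · rw [h]
      exact zero_le_one
    · rw [← h]
      exact ht i
  refine ⟨n, ⟨fun i => e.symm ⟨t i, hmem i⟩, ?_⟩, fun j => (e j.succ : ℝ≥0), ⟨?_, fun j => ?_⟩,
    ?_, ?_⟩
  · intro j hj
    have := (e j).2
    simp only [E, Finset.mem_insert, Finset.mem_image, Finset.mem_univ, true_and] at this
    obtain h | ⟨i, h⟩ := this
    · refine absurd (e.injective (Subtype.ext ?_)) hj
      rw [h, h₀]
    · refine ⟨i, ?_⟩
      rw [OrderIso.symm_apply_eq]
      exact Subtype.ext h
  · rw [hcons]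
    exact hmono.monotone
  · exact_mod_cast hle j.succ
  · rw [hcons]
    exact hmono
  · funext i
    rw [cubePoint, hcons]
    simp

theorem exists_weakOrder_of_lt_one [Finite S] (t : S → ℝ≥0) (ht : ∀ i, t i < 1) :
    ∃ (n : ℕ) (c : WeakOrder S n), ∃ u ∈ openSimplex n, t = cubePoint c.1 u := by
  obtain ⟨n, c, u, hu, hmono, h⟩ := exists_weakOrder t fun i => (ht i).le
  refine ⟨n, c, u, ⟨hmono, fun j => ?_⟩, h⟩
  obtain ⟨i, hi⟩ := c.2 j.succ (Fin.succ_ne_zero j)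
  have := coe_cubePoint c.1 hu i
  rw [hi, Fin.cons_succ, ← h] at this
  rw [← this]
  exact_mod_cast ht i

/-- A boundary point of the simplex has, modulo `1`, fewer different nonzero coordinates. -/
theorem dim_lt_of_fractVec_eq {n m : ℕ} {c : WeakOrder S n} {d : WeakOrder S m} {u : Fin n → ℝ}
    {w : Fin m → ℝ} (hu : u ∈ closedSimplex n) (hu' : u ∉ openSimplex n) (hw : w ∈ openSimplex m)
    (h : fractVec (cubePoint c.1 u) = cubePoint d.1 w) : m < n := by
  classical
  have hw' := openSimplex_subset_closedSimplex m hw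
  have hpos : ∀ j, 0 < w j := fun j => by simpa using hw.1 (Fin.succ_pos j)
  -- Taking fractional parts sends the value `1` to `0` and keeps the rest, so the values of `w` are
  -- values of `u` strictly between `0` and `1`.
  have hsub : Finset.univ.image w ⊆ ((Finset.univ.image u).erase 0).erase 1 := by
    intro x hx
    obtain ⟨j, -, rfl⟩ := Finset.mem_image.1 hx
    obtain ⟨i, hi⟩ := d.2 j.succ (Fin.succ_ne_zero j)
    have h₁ : (cubePoint d.1 w i : ℝ) = w j := by
      rw [coe_cubePoint d.1 hw', hi, Fin.cons_succ]
    have h₂ : cubePoint c.1 u i < 1 := by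
      refine lt_of_le_of_ne (cubePoint_le_one c.1 hu i) fun hone => ?_
      have := congrFun h i
      simp only [fractVec] at this
      rw [hone, Nat.floor_one, Nat.cast_one, tsub_self] at this
      rw [← this, NNReal.coe_zero] at h₁
      exact (hpos j).ne h₁
    have h₃ : cubePoint c.1 u i = cubePoint d.1 w i := by
      rw [← h]
      simp [fractVec, Nat.floor_eq_zero.2 h₂]
    rw [← h₃, coe_cubePoint c.1 hu] at h₁
    refine Finset.mem_erase.2 ⟨(hw.2 j).ne, Finset.mem_erase.2 ⟨(hpos j).ne', ?_⟩⟩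
    refine Finset.mem_image.2 ?_
    rcases Fin.eq_zero_or_eq_succ (c.1 i) with hz | ⟨k, hk⟩
    · rw [hz, Fin.cons_zero] at h₁
      exact absurd h₁ (hpos j).ne
    · rw [hk, Fin.cons_succ] at h₁
      exact ⟨k, Finset.mem_univ _, h₁⟩
  have hwinj : Function.Injective w := fun i j hij =>
    Fin.succ_injective _ (hw.1.injective (by simpa using hij))
  have hcard : (Finset.univ.image w).card = m := by
    rw [Finset.card_image_of_injective _ hwinj, Finset.card_univ, Fintype.card_fin]
  have hle : (Finset.univ.image u).card ≤ n := by
    simpa using Finset.card_image_le (s := Finset.univ) (f := u)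
  -- If no value were lost, `u` would be injective and avoid `0` and `1`, which places it in the
  -- open simplex.
  by_contra! hnm
  have h₁ := Finset.card_le_card hsub
  rw [hcard] at h₁
  have hsub' : ((Finset.univ.image u).erase 0).erase 1 ⊆ Finset.univ.image u :=
    (Finset.erase_subset _ _).trans (Finset.erase_subset _ _)
  have heq := Finset.eq_of_subset_of_card_le hsub' (by omega)
  have huinj : Function.Injective u := by
    rw [← Finset.card_image_iff.trans (by simp [Set.injOn_univ] :
      Set.InjOn u ↑(Finset.univ : Finset (Fin n)) ↔ Function.Injective u)]
    have := Finset.card_le_card hsub'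
    rw [Finset.card_univ, Fintype.card_fin]
    omega
  have hne : ∀ j, u j ≠ 1 ∧ u j ≠ 0 := by
    intro j
    have hj : u j ∈ ((Finset.univ.image u).erase 0).erase 1 := by
      rw [heq]
      exact Finset.mem_image_of_mem u (Finset.mem_univ j)
    exact ⟨(Finset.mem_erase.1 hj).1, (Finset.mem_erase.1 (Finset.mem_erase.1 hj).2).1⟩
  refine hu' ⟨hu.1.strictMono_of_injective ?_, fun j => lt_of_le_of_ne (hu.2 j) (hne j).1⟩
  rw [Fin.cons_injective_iff]
  exact ⟨fun ⟨j, hj⟩ => (hne j).2 hj, huinj⟩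

end WeakOrders

/-- Closed subsets of `K` have compact, hence closed, images. By `hd` no boundary point of `K` maps
into the target, so these images cut out the right preimages there. -/
theorem PartialEquiv.continuousOn_symm_of_isCompact {E X : Type*} [TopologicalSpace E]
    [TopologicalSpace X] [T2Space X] (e : PartialEquiv E X) {K : Set E} (hK : IsCompact K)
    (hs : e.source ⊆ K) (hc : ContinuousOn e K) (hd : ∀ x ∈ K, e x ∈ e.target → x ∈ e.source) :
    ContinuousOn e.symm e.target := by
  rw [continuousOn_iff_isClosed]
  intro C hC
  refine ⟨e '' (K ∩ C), ((hK.inter_right hC).image_of_continuousOn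
    (hc.mono Set.inter_subset_left)).isClosed, ?_⟩
  ext y
  constructor
  · rintro ⟨hy, hy'⟩
    exact ⟨⟨e.symm y, ⟨hs (e.map_target hy'), hy⟩, e.right_inv hy'⟩, hy'⟩
  · rintro ⟨⟨x, ⟨hxK, hxC⟩, rfl⟩, hy'⟩
    refine ⟨?_, hy'⟩
    rw [Set.mem_preimage, e.left_inv (hd x hxK hy')]
    exact hxC

theorem locallyFinite_cubes {S : Type*} [Finite S] :
    LocallyFinite fun k : S → ℕ => {t : S → ℝ≥0 | ∀ i, (k i : ℝ≥0) ≤ t i} ∩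
      {t | ∀ i, t i ≤ k i + 1} := by
  classical
  cases nonempty_fintype S
  intro t
  refine ⟨{s | ∀ i, s i < t i + 1}, ?_, ?_⟩
  · change ∀ᶠ s : S → ℝ≥0 in nhds t, ∀ i, s i < t i + 1
    rw [Filter.eventually_all]
    exact fun i => (continuous_apply i).continuousAt.eventually_lt_const (lt_add_one (t i))
  · refine (Set.finite_Iic (fun i => ⌈t i + 1⌉₊ : S → ℕ)).subset ?_
    rintro k ⟨s, ⟨h₁, -⟩, h₂⟩ i
    have : (k i : ℝ≥0) ≤ ⌈t i + 1⌉₊ := ((h₁ i).trans (h₂ i).le).trans (Nat.le_ceil _)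
    exact_mod_cast this

/-! ### The CW structure of the telescope -/

namespace Telescope

section Cells

variable {S V : Type u} [AddAction (S → ℕ) V]

/-- The parametrization by a simplex of the cell of the telescope with vertex `v` and weak
ordering `c`. -/
noncomputable def simplexMap {n : ℕ} (i : V × WeakOrder S n) (u : Fin n → ℝ) : Telescope S V :=
  mk i.1 (cubePoint i.2.1 u)

theorem continuous_simplexMap {n : ℕ} (i : V × WeakOrder S n) :
    Continuous (simplexMap i : (Fin n → ℝ) → Telescope S V) :=
  (continuous_mk i.1).comp (continuous_cubePoint i.2.1)

theorem dim_eq_of_simplexMap_eq {n m : ℕ} {i : V × WeakOrder S n} {j : V × WeakOrder S m}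
    {u : Fin n → ℝ} {w : Fin m → ℝ} (hu : u ∈ openSimplex n) (hw : w ∈ openSimplex m)
    (h : (simplexMap i u : Telescope S V) = simplexMap j w) : n = m :=
  dim_eq_of_cubePoint_eq hu hw
    ((mk_eq_mk_of_lt_one (cubePoint_lt_one _ hu) (cubePoint_lt_one _ hw)).1 h).2

theorem simplexMap_injective {n : ℕ} {i j : V × WeakOrder S n}
    {u w : Fin n → ℝ} (hu : u ∈ openSimplex n) (hw : w ∈ openSimplex n)
    (h : (simplexMap i u : Telescope S V) = simplexMap j w) : i = j ∧ u = w := by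
  obtain ⟨h₁, h₂⟩ := (mk_eq_mk_of_lt_one (cubePoint_lt_one _ hu) (cubePoint_lt_one _ hw)).1 h
  obtain ⟨h₃, h₄⟩ := cubePoint_injective hu hw h₂
  exact ⟨Prod.ext h₁ h₃, h₄⟩

theorem injOn_simplexMap_ballToSimplex {n : ℕ} (i : V × WeakOrder S n) :
    Set.InjOn (simplexMap i ∘ ballToSimplex n : (Fin n → ℝ) → Telescope S V)
      (Metric.ball 0 1) := by
  intro x hx y hy hxy
  have h := fun x (hx : x ∈ Metric.ball (0 : Fin n → ℝ) 1) =>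
    (ballToSimplex_ball n).subset (Set.mem_image_of_mem _ hx)
  exact (ballToSimplex n).injective (simplexMap_injective (h x hx) (h y hy) hxy).2

/-- The characteristic map of a cell of the telescope. -/
noncomputable def cellMap {n : ℕ} (i : V × WeakOrder S n) :
    PartialEquiv (Fin n → ℝ) (Telescope S V) :=
  (injOn_simplexMap_ballToSimplex i).toPartialEquiv _ _

theorem coe_cellMap {n : ℕ} (i : V × WeakOrder S n) :
    (cellMap i : (Fin n → ℝ) → Telescope S V) = simplexMap i ∘ ballToSimplex n := rfl

theorem cellMap_image_ball {n : ℕ} (i : V × WeakOrder S n) :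
    (cellMap i : (Fin n → ℝ) → Telescope S V) '' Metric.ball 0 1 =
      simplexMap i '' openSimplex n := by
  rw [coe_cellMap, Set.image_comp, ballToSimplex_ball]

theorem cellMap_image_closedBall {n : ℕ} (i : V × WeakOrder S n) :
    (cellMap i : (Fin n → ℝ) → Telescope S V) '' Metric.closedBall 0 1 =
      simplexMap i '' closedSimplex n := by
  rw [coe_cellMap, Set.image_comp, ballToSimplex_closedBall]

theorem ballToSimplex_mem_openSimplex {n : ℕ} {x : Fin n → ℝ} :
    ballToSimplex n x ∈ openSimplex n ↔ x ∈ Metric.ball 0 1 := by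
  rw [← ballToSimplex_ball, (ballToSimplex n).injective.mem_set_image]

theorem ballToSimplex_mem_closedSimplex {n : ℕ} {x : Fin n → ℝ} :
    ballToSimplex n x ∈ closedSimplex n ↔ x ∈ Metric.closedBall 0 1 := by
  rw [← ballToSimplex_closedBall, (ballToSimplex n).injective.mem_set_image]

variable [Fintype S]

theorem exists_simplexMap_eq (x : Telescope S V) :
    ∃ (n : ℕ) (i : V × WeakOrder S n), ∃ u ∈ openSimplex n, x = simplexMap i u := by
  obtain ⟨v, t, ht, rfl⟩ := exists_eq_mk_lt_one x
  obtain ⟨n, c, u, hu, rfl⟩ := exists_weakOrder_of_lt_one t ht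
  exact ⟨n, (v, c), u, hu, rfl⟩

/-- Coordinates equal to `1` are moved into the vertex, and the fractional part has fewer distinct
nonzero values. The displacement is recorded in `S → Fin 2` so that only finitely many cells can
meet the boundary. -/
theorem exists_simplexMap_eq_of_boundary {n : ℕ} (i : V × WeakOrder S n) {u : Fin n → ℝ}
    (hu : u ∈ closedSimplex n) (hu' : u ∉ openSimplex n) :
    ∃ (m : ℕ) (k : S → Fin 2) (d : WeakOrder S m), ∃ w ∈ openSimplex m, m < n ∧
      (simplexMap i u : Telescope S V) =
        simplexMap ((fun s => (k s : ℕ) : S → ℕ) +ᵥ i.1, d) w := by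
  obtain ⟨m, d, w, hw, h⟩ := exists_weakOrder_of_lt_one _ (fractVec_lt_one (cubePoint i.2.1 u))
  refine ⟨m, fun s => ⟨floorVec (cubePoint i.2.1 u) s, ?_⟩, d, w, hw,
    dim_lt_of_fractVec_eq hu hu' hw h, ?_⟩
  · have : floorVec (cubePoint i.2.1 u) s ≤ ⌊(1 : ℝ≥0)⌋₊ :=
      Nat.floor_mono (cubePoint_le_one i.2.1 hu s)
    rw [Nat.floor_one] at this
    omega
  · rw [simplexMap, simplexMap, ← h, ← mk_natVec_add, natVec_floorVec_add_fractVec]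

theorem mem_openSimplex_of_simplexMap_eq {n : ℕ} (i j : V × WeakOrder S n)
    {u w : Fin n → ℝ} (hu : u ∈ closedSimplex n) (hw : w ∈ openSimplex n)
    (h : (simplexMap i u : Telescope S V) = simplexMap j w) : u ∈ openSimplex n := by
  by_contra hu'
  obtain ⟨_, k, d, w', hw', hmn, h'⟩ := exists_simplexMap_eq_of_boundary i hu hu'
  exact hmn.ne (dim_eq_of_simplexMap_eq hw' hw (h'.symm.trans h))

/-- Each chart is a locally finite union of translated closed simplices, and each of these maps onto
a closed cell. -/
theorem isClosed_of_simplices (A : Set (Telescope S V))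
    (hA : ∀ (n : ℕ) (i : V × WeakOrder S n), IsClosed (A ∩ simplexMap i '' closedSimplex n)) :
    IsClosed A := by
  rw [isClosed_iff]
  intro v
  let K : (S → ℕ) → (Σ n, WeakOrder S n) → Set (S → ℝ≥0) := fun k c =>
    (fun u => natVec k + cubePoint c.2.1 u) '' closedSimplex c.1
  have hK : ∀ k c, IsClosed (K k c) := fun k c => by
    refine (IsCompact.image ?_ (continuous_const.add (continuous_cubePoint _))).isClosed
    exact Metric.isCompact_of_isClosed_isBounded (isClosed_closedSimplex _)
      (isBounded_closedSimplex _)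
  have hcover : mk v ⁻¹' A = ⋃ k, ⋃ c, K k c ∩ mk v ⁻¹' A := by
    refine Set.Subset.antisymm (fun t ht => ?_) (by simp)
    obtain ⟨n, c, u, hu, h⟩ := exists_weakOrder_of_lt_one _ (fractVec_lt_one t)
    refine Set.mem_iUnion₂.2 ⟨floorVec t, ⟨n, c⟩, ⟨u, openSimplex_subset_closedSimplex n hu, ?_⟩, ht⟩
    dsimp only
    rw [← h, natVec_floorVec_add_fractVec]
  have hclosed : ∀ k c, IsClosed (K k c ∩ mk v ⁻¹' A) := by
    intro k c
    have : K k c ∩ mk v ⁻¹' A =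
        K k c ∩ mk v ⁻¹' (A ∩ simplexMap (k +ᵥ v, c.2) '' closedSimplex c.1) := by
      refine Set.Subset.antisymm ?_ (Set.inter_subset_inter_right _
        (Set.preimage_mono Set.inter_subset_left))
      rintro _ ⟨⟨u, hu, rfl⟩, h⟩
      exact ⟨⟨u, hu, rfl⟩, h, u, hu, (mk_natVec_add _ _ _).symm⟩
    rw [this]
    exact (hK k c).inter ((hA _ _).preimage (continuous_mk v))
  rw [hcover]
  refine LocallyFinite.isClosed_iUnion (locallyFinite_cubes.subset fun k => ?_)
    fun k => isClosed_iUnion_of_finite (hclosed k)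
  refine Set.iUnion_subset fun c => ?_
  rintro _ ⟨⟨u, hu, rfl⟩, -⟩
  refine ⟨fun i => le_self_add, fun i => ?_⟩
  exact add_le_add_right (cubePoint_le_one c.2.1 hu i) _

noncomputable instance : Topology.CWComplex (Set.univ : Set (Telescope S V)) where
  cell n := V × WeakOrder S n
  map n i := cellMap i
  source_eq n i := rfl
  continuousOn n i :=
    ((continuous_simplexMap i).comp (ballToSimplex n).continuous).continuousOn
  continuousOn_symm n i := by
    refine PartialEquiv.continuousOn_symm_of_isCompact _ (isCompact_closedBall 0 1)
      Metric.ball_subset_closedBall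
      ((continuous_simplexMap i).comp (ballToSimplex n).continuous).continuousOn ?_
    rintro x hx ⟨y, hy, hxy⟩
    exact ballToSimplex_mem_openSimplex.1 (mem_openSimplex_of_simplexMap_eq i i
      (ballToSimplex_mem_closedSimplex.2 hx) (ballToSimplex_mem_openSimplex.2 hy) hxy.symm)
  pairwiseDisjoint' := by
    rintro ⟨n, i⟩ - ⟨m, j⟩ - hne
    rw [Function.onFun, Set.disjoint_left]
    dsimp only
    rw [cellMap_image_ball, cellMap_image_ball]
    rintro _ ⟨u, hu, rfl⟩ ⟨w, hw, h⟩
    obtain rfl := dim_eq_of_simplexMap_eq hw hu h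
    obtain ⟨rfl, -⟩ := simplexMap_injective hw hu h
    exact hne rfl
  mapsTo' n i := by
    classical
    refine ⟨fun m => (Set.finite_range fun p : (S → Fin 2) × WeakOrder S m =>
      (((fun s => (p.1 s : ℕ) : S → ℕ) +ᵥ i.1, p.2) : V × WeakOrder S m)).toFinset, ?_⟩
    intro x hx
    have hu : ballToSimplex n x ∉ openSimplex n := fun h => by
      have h₁ := ballToSimplex_mem_openSimplex.1 h
      rw [Metric.mem_ball] at h₁
      exact h₁.ne hx
    obtain ⟨m, k, d, w, hw, hmn, h⟩ := exists_simplexMap_eq_of_boundary i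
      (ballToSimplex_mem_closedSimplex.2 (Metric.sphere_subset_closedBall hx)) hu
    refine Set.mem_iUnion₂.2 ⟨m, hmn, Set.mem_iUnion₂.2
      ⟨((fun s => (k s : ℕ) : S → ℕ) +ᵥ i.1, d), ?_, ?_⟩⟩
    · rw [Set.Finite.mem_toFinset]
      exact ⟨(k, d), rfl⟩
    · rw [cellMap_image_closedBall]
      exact ⟨w, openSimplex_subset_closedSimplex m hw, h.symm⟩
  closed' A _ hA := by
    refine isClosed_of_simplices A fun n i => ?_
    rw [← cellMap_image_closedBall]
    exact hA n i
  union' := by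
    refine Set.eq_univ_of_forall fun x => ?_
    obtain ⟨n, i, u, hu, rfl⟩ := exists_simplexMap_eq x
    refine Set.mem_iUnion₂.2 ⟨n, i, ?_⟩
    rw [cellMap_image_closedBall]
    exact ⟨u, openSimplex_subset_closedSimplex n hu, rfl⟩

theorem openCell_eq {n : ℕ} (i : V × WeakOrder S n) :
    Topology.RelCWComplex.openCell (C := (Set.univ : Set (Telescope S V))) n i =
      simplexMap i '' openSimplex n :=
  cellMap_image_ball i

instance : Topology.RelCWComplex.FiniteDimensional (Set.univ : Set (Telescope S V)) where
  eventually_isEmpty_cell := by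
    filter_upwards [Filter.eventually_gt_atTop (Fintype.card S)] with n hn
    exact ⟨fun i : V × WeakOrder S n => (i.2.le_card.trans_lt hn).false⟩

end Cells

/-! ### Group actions that permute the directions -/

section Action

variable {S V : Type u} [AddAction (S → ℕ) V] {G : Type u} [Group G] [MulAction G S] [MulAction G V]

theorem floorVec_smul (g : G) (t : S → ℝ≥0) :
    floorVec (fun i => t (g⁻¹ • i)) = fun i => floorVec t (g⁻¹ • i) := rfl

theorem fractVec_smul (g : G) (t : S → ℝ≥0) :
    fractVec (fun i => t (g⁻¹ • i)) = fun i => fractVec t (g⁻¹ • i) := rfl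

/-- The action of a group on the telescope that is induced by compatible actions on the vertices
and on the directions. -/
@[reducible]
noncomputable def mulAction (hG : ∀ (g : G) (k : S → ℕ) (v : V),
    g • (k +ᵥ v) = (fun i => k (g⁻¹ • i)) +ᵥ g • v) : MulAction G (Telescope S V) where
  smul g := Quotient.lift (fun p => mk (g • p.1) fun i => p.2 (g⁻¹ • i)) <| by
    rintro ⟨v, t⟩ ⟨w, t'⟩ h
    obtain ⟨h₁, h₂⟩ := mk_eq_mk.1 (Quotient.sound h : mk v t = mk w t')
    refine mk_eq_mk.2 ⟨?_, ?_⟩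
    · rw [floorVec_smul, floorVec_smul, ← hG, ← hG, h₁]
    · rw [fractVec_smul, fractVec_smul, h₂]
  one_smul x := by
    obtain ⟨v, t, rfl⟩ := mk_surjective x
    change mk ((1 : G) • v) (fun i => t ((1 : G)⁻¹ • i)) = mk v t
    simp
  mul_smul g h x := by
    obtain ⟨v, t, rfl⟩ := mk_surjective x
    change mk ((g * h) • v) (fun i => t ((g * h)⁻¹ • i)) =
      mk (g • h • v) (fun i => t (h⁻¹ • g⁻¹ • i))
    simp [mul_smul]

variable (hG : ∀ (g : G) (k : S → ℕ) (v : V),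
    g • (k +ᵥ v) = (fun i => k (g⁻¹ • i)) +ᵥ g • v)

theorem smul_mk (g : G) (v : V) (t : S → ℝ≥0) :
    letI := mulAction hG
    g • mk v t = mk (g • v) fun i => t (g⁻¹ • i) := rfl

/-- The action on the cells of the telescope. -/
def smulCell {n : ℕ} (g : G) (i : V × WeakOrder S n) : V × WeakOrder S n :=
  (g • i.1, ⟨fun s => i.2.1 (g⁻¹ • s), fun j hj => by
    obtain ⟨s, hs⟩ := i.2.2 j hj
    exact ⟨g • s, (congrArg i.2.1 (inv_smul_smul g s)).trans hs⟩⟩)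

theorem smul_simplexMap {n : ℕ} (g : G) (i : V × WeakOrder S n) (u : Fin n → ℝ) :
    letI := mulAction hG
    g • (simplexMap i u : Telescope S V) = simplexMap (smulCell g i) u := rfl

/-- The representative in the half-open cube is unique and the action preserves that cube, so fixing
the point fixes its vertex. -/
theorem exists_stabilizer_le (x : Telescope S V) :
    letI := mulAction hG
    ∃ v : V, MulAction.stabilizer G x ≤ MulAction.stabilizer G v := by
  let := mulAction hG
  obtain ⟨v, t, ht, rfl⟩ := exists_eq_mk_lt_one x
  refine ⟨v, fun g hg => ?_⟩
  rw [MulAction.mem_stabilizer_iff, smul_mk] at hg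
  exact ((mk_eq_mk_of_lt_one (fun i => ht _) ht).1 hg).1

variable [Fintype S]

theorem smul_openCell {n : ℕ} (g : G) (i : V × WeakOrder S n) :
    letI := mulAction hG
    (fun x : Telescope S V => g • x) '' Topology.RelCWComplex.openCell
      (C := (Set.univ : Set (Telescope S V))) n i =
      Topology.RelCWComplex.openCell (C := (Set.univ : Set (Telescope S V))) n (smulCell g i) := by
  rw [openCell_eq, openCell_eq, ← Set.image_comp]
  rfl

/-- The action changes the label of a simplex and leaves its parameter `u` alone. Since distinct
labels give distinct open cells, an element preserving a cell fixes all its points, even if it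
permutes directions. -/
theorem isGComplex : @IsGComplex G (Telescope S V) _ _ (mulAction hG) _ := by
  let := mulAction hG
  refine ⟨inferInstance, fun g => ?_, fun g n i => ⟨smulCell g i, smul_openCell hG g i⟩,
    fun g n i h x hx => ?_⟩
  · rw [continuous_iff]
    intro v
    simp only [smul_mk]
    exact (continuous_mk _).comp (by fun_prop)
  · rw [smul_openCell hG g i] at h
    have h' : smulCell g i = i := Topology.RelCWComplex.openCell_congr n h
    rw [openCell_eq] at hx
    obtain ⟨u, hu, rfl⟩ := hx
    rw [smul_simplexMap, h']

end Action

end Telescope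

theorem actsWithStabilizersIn_of_telescope {G S V : Type u} [Group G] [Finite S] [Nonempty V]
    [AddAction (S → ℕ) V] [MulAction G S] [MulAction G V]
    (hdir : ∀ v w : V, ∃ a b : S → ℕ, a +ᵥ v = b +ᵥ w)
    (hfree : ∀ (v : V) (a b : S → ℕ), a +ᵥ v = b +ᵥ v → a = b)
    (hG : ∀ (g : G) (k : S → ℕ) (v : V), g • (k +ᵥ v) = (fun i => k (g⁻¹ • i)) +ᵥ g • v)
    (𝔛 : GroupClass.{u})
    (h𝔛 : ∀ (v : V) (K : Subgroup G), K ≤ MulAction.stabilizer G v → 𝔛 K) :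
    actsWithStabilizersIn 𝔛 G := by
  cases nonempty_fintype S
  refine ⟨Telescope S V, inferInstance, Telescope.mulAction hG, inferInstance,
    Telescope.isGComplex hG, inferInstance, Telescope.contractibleSpace hdir hfree, fun x => ?_⟩
  obtain ⟨v, hv⟩ := Telescope.exists_stabilizer_le hG x
  exact h𝔛 v _ hv

/-! ### Coinduction from a subgroup of finite index -/

section Coinduction

variable {G : Type u} [Group G] (H : Subgroup G) (V : Type u) [MulAction H V]

/-- The `G`-set coinduced from an `H`-set `V`. -/
@[ext]
structure CoinducedSet : Type u where
  /-- The underlying function. -/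
  toFun : G → V
  map_mul (g : G) (h : H) : toFun (g * h) = h⁻¹ • toFun g

namespace CoinducedSet

variable {H V}

instance : MulAction G (CoinducedSet H V) where
  smul g φ := ⟨fun x => φ.toFun (g⁻¹ * x), fun x h => by rw [← mul_assoc, φ.map_mul]⟩
  one_smul φ := CoinducedSet.ext (funext fun x => by
    change φ.toFun (1⁻¹ * x) = φ.toFun x
    simp)
  mul_smul g h φ := CoinducedSet.ext (funext fun x => by
    change φ.toFun ((g * h)⁻¹ * x) = φ.toFun (h⁻¹ * (g⁻¹ * x))
    simp [mul_assoc])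

theorem smul_apply (g : G) (φ : CoinducedSet H V) (x : G) : (g • φ).toFun x = φ.toFun (g⁻¹ * x) := rfl

theorem ext_out {φ ψ : CoinducedSet H V}
    (h : ∀ q : G ⧸ H, φ.toFun (Quotient.out q) = ψ.toFun (Quotient.out q)) : φ = ψ := by
  refine CoinducedSet.ext (funext fun g => ?_)
  obtain ⟨k, hk⟩ := QuotientGroup.mk_out_eq_mul H g
  have hg : g = Quotient.out (g : G ⧸ H) * (k⁻¹ : H) := by rw [hk]; simp
  rw [hg, φ.map_mul, ψ.map_mul, h]

/-- The element of the coinduced set with constant value on coset representatives. -/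
noncomputable def const (v : V) : CoinducedSet H V :=
  ⟨fun g => (⟨(Quotient.out (g : G ⧸ H))⁻¹ * g,
    QuotientGroup.eq.1 (QuotientGroup.out_eq' (g : G ⧸ H))⟩ : H)⁻¹ • v, fun g h => by
    have hq : ((g * h : G) : G ⧸ H) = g := QuotientGroup.mk_mul_of_mem g h.2
    rw [← mul_smul, ← mul_inv_rev]
    refine congrArg (fun k : H => k⁻¹ • v) (Subtype.ext ?_)
    change _⁻¹ * (g * h) = (_⁻¹ * g) * h
    rw [hq, mul_assoc]⟩

instance [Nonempty V] : Nonempty (CoinducedSet H V) := ⟨const (Classical.arbitrary V)⟩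

section Directions

variable {S : Type*} [AddAction (S → ℕ) V]

/-- The coordinates of `ℕ ^ (S × G ⧸ H)` act on the values of a function on the cosets of `H`. -/
@[reducible]
def addAction (hH : ∀ (h : H) (k : S → ℕ) (v : V), h • (k +ᵥ v) = k +ᵥ h • v) :
    AddAction (S × G ⧸ H → ℕ) (CoinducedSet H V) where
  vadd k φ := ⟨fun g => (fun s => k (s, (g : G ⧸ H))) +ᵥ φ.toFun g, fun g h => by
    rw [QuotientGroup.mk_mul_of_mem g h.2, φ.map_mul, hH]⟩
  zero_vadd φ := CoinducedSet.ext (funext fun g => zero_vadd (S → ℕ) (φ.toFun g))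
  add_vadd k l φ := CoinducedSet.ext (funext fun g =>
    add_vadd (fun s => k (s, (g : G ⧸ H))) (fun s => l (s, (g : G ⧸ H))) (φ.toFun g))

end Directions
end CoinducedSet

/-- The action of `G` on `S × G ⧸ H` through the second factor. -/
@[reducible]
def cosetDirections (S : Type*) : MulAction G (S × G ⧸ H) where
  smul g p := (p.1, g • p.2)
  one_smul p := Prod.ext rfl (one_smul G p.2)
  mul_smul g h p := Prod.ext rfl (mul_smul g h p.2)

/-- The coinduced set amounts to one copy of `V` for each coset, each with its own set of
directions; finite index keeps the number of directions finite. Directedness and freeness are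
checked on coset representatives. -/
theorem actsWithStabilizersIn_of_finiteIndex [H.FiniteIndex] {S : Type} [Finite S] [Nonempty V]
    [AddAction (S → ℕ) V]
    (hdir : ∀ v w : V, ∃ a b : S → ℕ, a +ᵥ v = b +ᵥ w)
    (hfree : ∀ (v : V) (a b : S → ℕ), a +ᵥ v = b +ᵥ v → a = b)
    (hH : ∀ (h : H) (k : S → ℕ) (v : V), h • (k +ᵥ v) = k +ᵥ h • v)
    (𝔛 : GroupClass.{u})
    (h𝔛 : ∀ (v : V) (K : Subgroup G), K.subgroupOf H ≤ MulAction.stabilizer H v → 𝔛 K) :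
    actsWithStabilizersIn 𝔛 G := by
  let := cosetDirections H S
  let := CoinducedSet.addAction hH
  have vadd_apply : ∀ (k : S × G ⧸ H → ℕ) (φ : CoinducedSet H V) (g : G),
    (k +ᵥ φ).toFun g = (fun s => k (s, (g : G ⧸ H))) +ᵥ φ.toFun g := fun _ _ _ => rfl
  refine actsWithStabilizersIn_of_telescope (S := S × G ⧸ H) (V := CoinducedSet H V)
    (fun φ ψ => ?_) (fun φ a b hab => ?_) (fun g k φ => ?_) 𝔛 fun φ K hK => ?_
  · choose a b hab using fun q : G ⧸ H => hdir (φ.toFun (Quotient.out q)) (ψ.toFun (Quotient.out q))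
    refine ⟨fun p => a p.2 p.1, fun p => b p.2 p.1, CoinducedSet.ext_out fun q => ?_⟩
    rw [vadd_apply, vadd_apply, QuotientGroup.out_eq']
    exact hab q
  · funext p
    have h := congrFun (congrArg CoinducedSet.toFun hab) (Quotient.out p.2)
    rw [vadd_apply, vadd_apply, QuotientGroup.out_eq'] at h
    exact congrFun (hfree _ _ _ h) p.1
  · exact CoinducedSet.ext (funext fun x => rfl)
  -- If `h` in `H` fixes `φ`, evaluation at `h` gives `φ 1 = φ h = h⁻¹ • φ 1`.
  · refine h𝔛 (φ.toFun 1) K fun h hh => ?_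
    have h₁ := congrFun (congrArg CoinducedSet.toFun (hK hh)) (h : G)
    rw [CoinducedSet.smul_apply] at h₁
    change φ.toFun ((h : G)⁻¹ * h) = φ.toFun h at h₁
    have h₂ := φ.map_mul 1 h
    rw [inv_mul_cancel] at h₁
    rw [one_mul, ← h₁] at h₂
    rw [MulAction.mem_stabilizer_iff]
    nth_rw 1 [h₂]
    rw [smul_inv_smul]

end Coinduction

/-! ### Actions of `ℕ ^ S` from commuting maps -/

section CommutingMaps

variable {S : Type*} [Fintype S] {V : Type*}

theorem pi_nat_induction [DecidableEq S] {p : (S → ℕ) → Prop} (h₀ : p 0)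
    (hadd : ∀ a b, p a → p b → p (a + b)) (hs : ∀ i, p (Pi.single i 1)) (k : S → ℕ) : p k := by
  have h : ∀ (n : ℕ) (i : S), p (Pi.single i n) := by
    intro n i
    induction n with
    | zero => simpa using h₀
    | succ n ih =>
      rw [Pi.single_add]
      exact hadd _ _ ih (hs i)
  rw [← Finset.univ_sum_single k]
  exact Finset.sum_induction _ p hadd h₀ fun i _ => h _ i

/-- The action of `ℕ ^ S` defined by a family of commuting self-maps. -/
@[reducible]
noncomputable def addActionOfCommute (f : S → V → V) (hf : ∀ i j v, f i (f j v) = f j (f i v)) :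
    AddAction (S → ℕ) V :=
  let F : (S → Multiplicative ℕ) →* Function.End V :=
    MonoidHom.noncommPiCoprod (fun i => powersHom (Function.End V) (f i)) fun i j _ x y => by
      have h : Commute (S := Function.End V) (f i) (f j) := funext (hf i j)
      exact h.pow_pow _ _
  { vadd := fun k v => F (fun i => Multiplicative.ofAdd (k i)) v
    zero_vadd := fun v => congrFun (map_one F) v
    add_vadd := fun k l v => congrFun (map_mul F (fun i => Multiplicative.ofAdd (k i))
      fun i => Multiplicative.ofAdd (l i)) v }

theorem single_vadd [DecidableEq S] (f : S → V → V) (hf : ∀ i j v, f i (f j v) = f j (f i v))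
    (i : S) (v : V) :
    letI := addActionOfCommute f hf
    (Pi.single i 1 : S → ℕ) +ᵥ v = f i v := by
  have h := MonoidHom.noncommPiCoprod_mulSingle (fun i => powersHom (Function.End V) (f i))
    (hcomm := fun i j _ x y => by
      have h : Commute (S := Function.End V) (f i) (f j) := funext (hf i j)
      exact h.pow_pow _ _) i (Multiplicative.ofAdd 1)
  refine Eq.trans ?_ (congrFun (h.trans (pow_one (M := Function.End V) (f i))) v)
  refine congrFun (congrArg _ (funext fun j => ?_)) v
  change Multiplicative.ofAdd ((Pi.single i 1 : S → ℕ) j) =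
    (Pi.mulSingle i (Multiplicative.ofAdd 1) : S → Multiplicative ℕ) j
  by_cases hj : j = i
  · subst hj
    rw [Pi.single_eq_same, Pi.mulSingle_eq_same]
  · rw [Pi.single_eq_of_ne hj, Pi.mulSingle_eq_of_ne hj, ofAdd_zero]

theorem vadd_map_of_comm [DecidableEq S] (f : S → V → V) (hf : ∀ i j v, f i (f j v) = f j (f i v))
    (e : V → V) (he : ∀ i v, e (f i v) = f i (e v)) (k : S → ℕ) (v : V) :
    letI := addActionOfCommute f hf
    e (k +ᵥ v) = k +ᵥ e v := by
  let := addActionOfCommute f hf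
  induction k using pi_nat_induction generalizing v with
  | h₀ => rw [zero_vadd, zero_vadd]
  | hadd a b iha ihb => rw [add_vadd, add_vadd, iha, ihb]
  | hs i => rw [single_vadd f hf, single_vadd f hf, he]

theorem vadd_weight [DecidableEq S] (f : S → V → V) (hf : ∀ i j v, f i (f j v) = f j (f i v))
    {M : Type*} [AddCommMonoid M] (wt : V → M) (c : S → M) (hw : ∀ i v, wt (f i v) = wt v + c i)
    (k : S → ℕ) (v : V) :
    letI := addActionOfCommute f hf
    wt (k +ᵥ v) = wt v + ∑ i, k i • c i := by
  let := addActionOfCommute f hf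
  induction k using pi_nat_induction generalizing v with
  | h₀ => simp [zero_vadd]
  | hadd a b iha ihb =>
    rw [add_vadd, iha, ihb, add_assoc, ← Finset.sum_add_distrib]
    congr 1
    refine Finset.sum_congr rfl fun i _ => ?_
    rw [Pi.add_apply, add_smul, add_comm]
  | hs i =>
    rw [single_vadd f hf, hw, Finset.sum_eq_single i]
    · simp
    · intro j _ hj
      simp [hj]
    · simp

end CommutingMaps

/-! ### Filtering a countable normal subgroup by finitely generated subgroups -/

section Filtration

variable {H : Type u} [Group H]

/-- Finite generating sets grow by recursion: begin with the commutators of the `t i`, then at each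
stage add the next element of an enumeration of `N` and the conjugates of all earlier generators. -/
theorem exists_filtration {S : Type*} [Finite S] (t : S → H) (N : Subgroup H) [N.Normal]
    [Countable N] (hcomm : ∀ i j, (t j * t i)⁻¹ * (t i * t j) ∈ N) :
    ∃ A : ℕ → Subgroup H, Monotone A ∧ (∀ m, A m ≤ N) ∧ (∀ m, (A m).FG) ∧
      (∀ n ∈ N, ∃ m, n ∈ A m) ∧ (∀ i m, ∀ a ∈ A m, (t i)⁻¹ * a * t i ∈ A (m + 1)) ∧
      ∀ i j m, (t j * t i)⁻¹ * (t i * t j) ∈ A m := by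
  obtain ⟨a, ha⟩ := exists_surjective_nat N
  let E : ℕ → Set H := fun m => Nat.rec
    (Set.range fun p : S × S => (t p.2 * t p.1)⁻¹ * (t p.1 * t p.2))
    (fun m Em => insert (a m : H) (Em ∪ ⋃ i, (fun x => (t i)⁻¹ * x * t i) '' Em)) m
  have hE : ∀ m, E (m + 1) = insert (a m : H) (E m ∪ ⋃ i, (fun x => (t i)⁻¹ * x * t i) '' E m) :=
    fun m => rfl
  have hmono : Monotone E := monotone_nat_of_le_succ fun m => by
    rw [hE]
    exact Set.subset_union_left.trans (Set.subset_insert _ _)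
  refine ⟨fun m => Subgroup.closure (E m), fun m n h => Subgroup.closure_mono (hmono h),
    fun m => ?_, fun m => ?_, fun n hn => ?_, fun i m x hx => ?_, fun i j m => ?_⟩
  · rw [Subgroup.closure_le]
    induction m with
    | zero =>
      rintro _ ⟨p, rfl⟩
      exact hcomm _ _
    | succ m ih =>
      rw [hE, Set.insert_subset_iff, Set.union_subset_iff, Set.iUnion_subset_iff]
      refine ⟨(a m).2, ih, ?_⟩
      rintro i _ ⟨x, hx, rfl⟩
      simpa using ‹N.Normal›.conj_mem x (ih hx) (t i)⁻¹
  · refine (Subgroup.fg_iff _).2 ⟨E m, rfl, ?_⟩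
    induction m with
    | zero => exact Set.finite_range _
    | succ m ih =>
      rw [hE]
      exact (ih.union (Set.finite_iUnion fun i => ih.image _)).insert _
  · obtain ⟨m, hm⟩ := ha ⟨n, hn⟩
    refine ⟨m + 1, Subgroup.subset_closure ?_⟩
    rw [hE, hm]
    exact Set.mem_insert _ _
  · have : (Subgroup.closure (E m)).map (MulAut.conj (t i)⁻¹).toMonoidHom ≤
        Subgroup.closure (E (m + 1)) := by
      rw [MonoidHom.map_closure]
      refine Subgroup.closure_mono ?_
      rw [hE]
      refine Set.Subset.trans ?_ (Set.subset_insert _ _)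
      refine Set.Subset.trans ?_ Set.subset_union_right
      refine Set.Subset.trans ?_ (Set.subset_iUnion _ i)
      rintro _ ⟨y, hy, rfl⟩
      exact ⟨y, hy, by simp⟩
    refine this ⟨x, hx, ?_⟩
    simp
  · exact Subgroup.closure_mono (hmono (Nat.zero_le m)) (Subgroup.subset_closure ⟨(i, j), rfl⟩)

/-- The translates of the members of a filtration. -/
def FiltrationCosets (A : ℕ → Subgroup H) : Type u := Σ m, H ⧸ A m

namespace FiltrationCosets

variable {A : ℕ → Subgroup H}

/-- The coset `g A m`. -/
def mk (m : ℕ) (g : H) : FiltrationCosets A := ⟨m, (g : H ⧸ A m)⟩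

theorem mk_surjective (x : FiltrationCosets A) : ∃ m g, x = mk m g := by
  obtain ⟨m, q⟩ := x
  obtain ⟨g, rfl⟩ := QuotientGroup.mk_surjective q
  exact ⟨m, g, rfl⟩

theorem mk_eq_mk {m : ℕ} {g h : H} : (mk m g : FiltrationCosets A) = mk m h ↔ g⁻¹ * h ∈ A m := by
  rw [← QuotientGroup.eq]
  exact sigma_mk_injective.eq_iff

instance : MulAction H (FiltrationCosets A) where
  smul h x := ⟨x.1, h • x.2⟩
  one_smul x := by
    obtain ⟨m, q⟩ := x
    exact congrArg (Sigma.mk m) (one_smul H q)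
  mul_smul g h x := by
    obtain ⟨m, q⟩ := x
    exact congrArg (Sigma.mk m) (mul_smul g h q)

theorem smul_mk (h : H) (m : ℕ) (g : H) : h • (mk m g : FiltrationCosets A) = mk m (h * g) := rfl

theorem mem_stabilizer_mk {h : H} {m : ℕ} {g : H} :
    h ∈ MulAction.stabilizer H (mk m g : FiltrationCosets A) ↔ g⁻¹ * h * g ∈ A m := by
  rw [MulAction.mem_stabilizer_iff, smul_mk, eq_comm, mk_eq_mk, mul_assoc]

variable {S : Type*} (t : S → H) (hA : ∀ i m, ∀ a ∈ A m, (t i)⁻¹ * a * t i ∈ A (m + 1))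

/-- Right translation by `t i`, from the cosets of `A m` to those of `A (m + 1)`. -/
def step (i : S) (x : FiltrationCosets A) : FiltrationCosets A :=
  ⟨x.1 + 1, Quotient.liftOn' x.2 (fun g => ((g * t i : H) : H ⧸ A (x.1 + 1))) fun g h hgh => by
    rw [QuotientGroup.leftRel_apply] at hgh
    rw [QuotientGroup.eq]
    simpa [mul_assoc] using hA i x.1 _ hgh⟩

theorem step_mk (i : S) (m : ℕ) (g : H) : step t hA i (mk m g) = mk (m + 1) (g * t i) := rfl

theorem step_comm (hcomm : ∀ i j m, (t j * t i)⁻¹ * (t i * t j) ∈ A m) (i j : S)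
    (x : FiltrationCosets A) : step t hA i (step t hA j x) = step t hA j (step t hA i x) := by
  obtain ⟨m, g, rfl⟩ := mk_surjective x
  simp only [step_mk]
  rw [mk_eq_mk]
  simpa [mul_assoc] using hcomm i j (m + 1 + 1)

theorem smul_step (h : H) (i : S) (x : FiltrationCosets A) :
    h • step t hA i x = step t hA i (h • x) := by
  obtain ⟨m, g, rfl⟩ := mk_surjective x
  simp only [step_mk, smul_mk, mul_assoc]

/-- The value of a homomorphism on a coset of a subgroup of its kernel. -/
def position {M : Type*} [AddGroup M] (χ : H →* Multiplicative M) (hχ : ∀ m, A m ≤ χ.ker)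
    (x : FiltrationCosets A) : M :=
  Quotient.liftOn' x.2 (fun g => (χ g).toAdd) fun g h hgh => by
    rw [QuotientGroup.leftRel_apply] at hgh
    have := hχ _ hgh
    rw [MonoidHom.mem_ker, map_mul, map_inv, inv_mul_eq_one] at this
    rw [this]

end FiltrationCosets
end Filtration

/-! ### The complex for a group with a finite-index subgroup mapping to `ℤ ^ n` -/

theorem subgroup_fg_map {H K : Type*} [Group H] [Group K] {B : Subgroup H} (hB : B.FG)
    (f : H →* K) : (B.map f).FG := by
  classical
  obtain ⟨s, rfl⟩ := hB
  exact ⟨s.image f, by rw [MonoidHom.map_closure, Finset.coe_image]⟩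

theorem actsWithStabilizersIn_of_surjective {G : Type u} [Group G] (H : Subgroup G)
    [H.FiniteIndex] {r : ℕ} (χ : H →* Multiplicative (Fin r → ℤ)) (hχ : Function.Surjective χ)
    [Countable χ.ker] (𝔛 : GroupClass.{u})
    (h𝔛 : ∀ (K : Subgroup G) (B : Subgroup H), B.FG → B ≤ χ.ker → K.subgroupOf H ≤ B → 𝔛 K) :
    actsWithStabilizersIn 𝔛 G := by
  choose t' ht' using fun j : Fin r => hχ (Multiplicative.ofAdd (Pi.single j 1))
  -- The extra direction `none` has translation `1`: it raises the level of the filtration without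
  -- moving the position in `ℤ ^ r`.
  let t : Option (Fin r) → H := fun i => i.elim 1 t'
  obtain ⟨A, hmono, hle, hfg, hex, hconj, hcomm⟩ := exists_filtration t χ.ker fun i j => by
    rw [MonoidHom.mem_ker, map_mul, map_inv, map_mul, map_mul, mul_comm (χ (t i)),
      inv_mul_cancel]
  have hstep := FiltrationCosets.step_comm t hconj hcomm
  let := addActionOfCommute _ hstep
  let pos := FiltrationCosets.position χ hle
  have hpos_mk : ∀ m g, pos (FiltrationCosets.mk m g) = (χ g).toAdd := fun _ _ => rfl
  have hlevel : ∀ (k : Option (Fin r) → ℕ) (x : FiltrationCosets A),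
      (k +ᵥ x).1 = x.1 + ∑ i, k i := by
    intro k x
    refine (vadd_weight _ hstep Sigma.fst (fun _ => 1) (fun _ _ => rfl) k x).trans ?_
    simp
  have hpos : ∀ (k : Option (Fin r) → ℕ) (x : FiltrationCosets A),
      pos (k +ᵥ x) = pos x + fun j => (k (some j) : ℤ) := by
    intro k x
    refine (vadd_weight _ hstep pos (fun i => (χ (t i)).toAdd) (fun i x => ?_) k x).trans ?_
    · obtain ⟨m, g, rfl⟩ := FiltrationCosets.mk_surjective x
      rw [FiltrationCosets.step_mk, hpos_mk, hpos_mk, map_mul, toAdd_mul]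
    · congr 1
      rw [Fintype.sum_option]
      funext j
      simp [t, ht', Finset.sum_apply, Pi.single_apply]
  have hup : ∀ (n m : ℕ) (g : H), (Pi.single none n : Option (Fin r) → ℕ) +ᵥ
      (FiltrationCosets.mk m g : FiltrationCosets A) = FiltrationCosets.mk (m + n) g := by
    intro n m g
    induction n with
    | zero => rw [Pi.single_zero, zero_vadd, add_zero]
    | succ n ih =>
      rw [add_comm n 1, Pi.single_add, add_vadd, ih, single_vadd _ hstep,
        FiltrationCosets.step_mk, add_assoc, add_comm 1 n]
      simp [t]
  have hne : Nonempty (FiltrationCosets A) := ⟨FiltrationCosets.mk 0 1⟩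
  refine actsWithStabilizersIn_of_finiteIndex H (FiltrationCosets A) (S := Option (Fin r))
    (fun x y => ?_) (fun x a b hab => ?_)
    (fun h k x => vadd_map_of_comm _ hstep (h • ·)
      (fun i x => FiltrationCosets.smul_step t hconj h i x) k x) 𝔛 fun x K hK => ?_
  -- Positive and negative parts of the difference equalize the positions; the `none` entries then
  -- equalize the levels. The two cosets now differ by an element of the kernel, absorbed by
  -- climbing to a level that contains it.
  · let a' : Fin r → ℕ := fun j => (pos y j - pos x j).toNat
    let b' : Fin r → ℕ := fun j => (pos x j - pos y j).toNat
    let a : Option (Fin r) → ℕ := fun i => i.elim (y.1 + ∑ j, b' j) a'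
    let b : Option (Fin r) → ℕ := fun i => i.elim (x.1 + ∑ j, a' j) b'
    obtain ⟨m, p, hp⟩ := FiltrationCosets.mk_surjective (a +ᵥ x)
    obtain ⟨l, q, hq⟩ := FiltrationCosets.mk_surjective (b +ᵥ y)
    have hml : m = l := by
      have h₁ := hlevel a x
      have h₂ := hlevel b y
      rw [hp, Fintype.sum_option] at h₁
      rw [hq, Fintype.sum_option] at h₂
      simp only [FiltrationCosets.mk, a, b, Option.elim_none, Option.elim_some] at h₁ h₂
      omega
    subst hml
    have hpq : χ p = χ q := by
      have h₁ := hpos a x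
      have h₂ := hpos b y
      rw [hp, hpos_mk] at h₁
      rw [hq, hpos_mk] at h₂
      refine Multiplicative.toAdd.injective (h₁.trans (Eq.trans ?_ h₂.symm))
      funext j
      simp only [Pi.add_apply, a, b, a', b', Option.elim_some]
      omega
    obtain ⟨n, hn⟩ := hex (p⁻¹ * q) (by rw [MonoidHom.mem_ker, map_mul, map_inv, hpq, inv_mul_cancel])
    refine ⟨Pi.single none n + a, Pi.single none n + b, ?_⟩
    rw [add_vadd, add_vadd, hp, hq, hup, hup, FiltrationCosets.mk_eq_mk]
    exact hmono (Nat.le_add_left n m) hn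
  -- Position recovers the `some` entries, and the level then recovers the `none` entry.
  · have h₁ := (hlevel a x).symm.trans ((congrArg Sigma.fst hab).trans (hlevel b x))
    have h₂ := (hpos a x).symm.trans ((congrArg pos hab).trans (hpos b x))
    have h₃ : ∀ j, a (some j) = b (some j) := fun j => by
      have := congrFun h₂ j
      simp only [Pi.add_apply] at this
      omega
    rw [Fintype.sum_option, Fintype.sum_option, Finset.sum_congr rfl fun j _ => h₃ j] at h₁
    funext i
    cases i with
    | none => omega
    | some j => exact h₃ j
  · obtain ⟨m, g, rfl⟩ := FiltrationCosets.mk_surjective x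
    refine h𝔛 K ((A m).map (MulAut.conj g).toMonoidHom) (subgroup_fg_map (hfg m) _) ?_ fun h hh => ?_
    · rintro _ ⟨y, hy, rfl⟩
      exact MonoidHom.normal_ker χ |>.conj_mem y (hle m hy) g
    · refine ⟨g⁻¹ * h * g, FiltrationCosets.mem_stabilizer_mk.1 (hK hh), ?_⟩
      simp [mul_assoc]

/-- The image is a subgroup of `ℤ ^ n`, hence free of finite rank; a basis identifies it with some
`ℤ ^ r`. -/
theorem exists_surjective_of_hom {H : Type*} [Group H] {n : ℕ}
    (χ : H →* Multiplicative (Fin n → ℤ)) :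
    ∃ (r : ℕ) (ψ : H →* Multiplicative (Fin r → ℤ)), Function.Surjective ψ ∧ ψ.ker = χ.ker := by
  let M : Submodule ℤ (Fin n → ℤ) := AddSubgroup.toIntSubmodule (MonoidHom.toAdditiveLeft χ).range
  let e := (Module.finBasis ℤ M).equivFun
  let f : H →* Multiplicative M :=
    { toFun := fun h => Multiplicative.ofAdd ⟨(χ h).toAdd, Additive.ofMul h, rfl⟩
      map_one' := by
        refine Multiplicative.toAdd.injective (Subtype.ext ?_)
        simp
      map_mul' := fun a b => by
        refine Multiplicative.toAdd.injective (Subtype.ext ?_)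
        simp }
  refine ⟨_, (AddMonoidHom.toMultiplicative e.toAddEquiv.toAddMonoidHom).comp f, ?_, ?_⟩
  · intro y
    obtain ⟨⟨x, h, hxh⟩, hx⟩ := e.surjective y.toAdd
    subst hxh
    exact ⟨h.toMul, Multiplicative.toAdd.injective hx⟩
  · ext h
    rw [MonoidHom.mem_ker, MonoidHom.mem_ker]
    change e ⟨(χ h).toAdd, Additive.ofMul h, rfl⟩ = 0 ↔ (χ h).toAdd = 0
    rw [LinearEquiv.map_eq_zero_iff]
    exact Subtype.ext_iff

theorem actsWithStabilizersIn_of_hom {G : Type u} [Group G] (H : Subgroup G)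
    [H.FiniteIndex] {n : ℕ} (χ : H →* Multiplicative (Fin n → ℤ))
    [Countable χ.ker] (𝔛 : GroupClass.{u})
    (h𝔛 : ∀ (K : Subgroup G) (B : Subgroup H), B.FG → B ≤ χ.ker → K.subgroupOf H ≤ B → 𝔛 K) :
    actsWithStabilizersIn 𝔛 G := by
  obtain ⟨r, ψ, hψ, hker⟩ := exists_surjective_of_hom χ
  have : Countable ψ.ker := by rwa [hker]
  exact actsWithStabilizersIn_of_surjective H ψ hψ 𝔛 (by rwa [hker])

theorem Subgroup.finiteIndex_comap {G Q : Type*} [Group G] [Group Q] (f : G →* Q) (H : Subgroup Q)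
    [H.FiniteIndex] : (H.comap f).FiniteIndex := by
  refine ⟨?_⟩
  rw [Subgroup.index_comap]
  exact (inferInstance : (H.subgroupOf f.range).FiniteIndex).index_ne_zero

/-! ### Virtually free abelian groups and the hierarchy over them -/

/-- The groups with a free abelian subgroup of finite rank and finite index. -/
def virtuallyFreeAbelianGroups : GroupClass.{u} := fun G _ =>
  ∃ H : Subgroup G, H.FiniteIndex ∧ ∃ (n : ℕ) (χ : H →* Multiplicative (Fin n → ℤ)),
    Function.Injective χ

namespace virtuallyFreeAbelianGroups

variable {G Q : Type u} [Group G] [Group Q]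

theorem of_injective (f : G →* Q) (hf : Function.Injective f)
    (hQ : virtuallyFreeAbelianGroups Q) : virtuallyFreeAbelianGroups G := by
  obtain ⟨H, hH, n, χ, hχ⟩ := hQ
  refine ⟨H.comap f, H.finiteIndex_comap f, n, χ.comp (f.subgroupComap H), hχ.comp fun a b hab => ?_⟩
  exact Subtype.ext (hf (congrArg Subtype.val hab))

theorem of_finiteIndex (K : Subgroup G) [hK : K.FiniteIndex]
    (h : virtuallyFreeAbelianGroups K) : virtuallyFreeAbelianGroups G := by
  obtain ⟨H, hH, n, χ, hχ⟩ := h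
  let e := H.equivMapOfInjective K.subtype K.subtype_injective
  refine ⟨H.map K.subtype, ⟨?_⟩, n, χ.comp e.symm.toMonoidHom, hχ.comp e.symm.injective⟩
  rw [Subgroup.index_map_subtype]
  exact mul_ne_zero hH.index_ne_zero hK.index_ne_zero

theorem of_fg (hG : Group.FG G) (hcomm : ∀ a b : G, a * b = b * a) :
    virtuallyFreeAbelianGroups G := by
  let : CommGroup G := { ‹Group G› with mul_comm := hcomm }
  obtain ⟨ι, j, _, _, p, hp, e, ⟨f⟩⟩ := CommGroup.equiv_free_prod_prod_multiplicative_zmod G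
  let π : G →* ((i : ι) → Multiplicative (ZMod (p i ^ e i))) :=
    (MonoidHom.snd (j → Multiplicative ℤ) _).comp f.toMonoidHom
  have : ∀ i, NeZero (p i ^ e i) := fun i => ⟨pow_ne_zero _ (hp i).ne_zero⟩
  have : ∀ i, Finite (Multiplicative (ZMod (p i ^ e i))) := fun i =>
    inferInstanceAs (Finite (ZMod (p i ^ e i)))
  let χ : π.ker →* Multiplicative (Fin (Fintype.card j) → ℤ) :=
    { toFun := fun g => Multiplicative.ofAdd fun k =>
        ((f g.1).1 ((Fintype.equivFin j).symm k)).toAdd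
      map_one' := by
        refine Multiplicative.toAdd.injective (funext fun k => ?_)
        simp
      map_mul' := fun a b => by
        refine Multiplicative.toAdd.injective (funext fun k => ?_)
        simp }
  refine ⟨π.ker, ⟨?_⟩, Fintype.card j, χ, fun a b hab => ?_⟩
  · rw [Subgroup.index_ker]
    exact Nat.card_pos.ne'
  · refine Subtype.ext (f.injective (Prod.ext (funext fun k => ?_) (a.2.trans b.2.symm)))
    have h := congrFun (congrArg Multiplicative.toAdd hab) (Fintype.equivFin j k)
    simpa [χ] using h

end virtuallyFreeAbelianGroups

theorem actsWithStabilizersIn_mono {𝔛 𝔜 : GroupClass.{u}}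
    (h : ∀ (G : Type u) [Group G], 𝔛 G → 𝔜 G) {G : Type u} [Group G]
    (hG : actsWithStabilizersIn 𝔛 G) : actsWithStabilizersIn 𝔜 G := by
  obtain ⟨X, i₁, i₂, i₃, h₁, h₂, h₃, h₄⟩ := hG
  exact ⟨X, i₁, i₂, i₃, h₁, h₂, h₃, fun x => h _ (h₄ x)⟩

/-- The same complex serves, with `G` acting through `π`; each stabilizer in `G` maps to the
stabilizer in `Q` by the restriction of `π`. -/
theorem actsWithStabilizersIn_of_pullback {𝔛 𝔜 : GroupClass.{u}} {G Q : Type u} [Group G]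
    [Group Q] (π : G →* Q)
    (h : ∀ (K : Subgroup G) (L : Subgroup Q) (ρ : K →* L), (∀ k, (ρ k : Q) = π k) → 𝔛 L → 𝔜 K)
    (hQ : actsWithStabilizersIn 𝔛 Q) : actsWithStabilizersIn 𝔜 G := by
  obtain ⟨X, i₁, i₂, i₃, h₁, h₂, h₃, h₄⟩ := hQ
  let act := MulAction.compHom X π
  refine ⟨X, i₁, act, i₃, ⟨h₁.t2, fun g => h₁.continuous_smul (π g),
    fun g => h₁.smul_openCell (π g), fun g => h₁.smul_eq_self (π g)⟩, h₂, h₃, fun x => ?_⟩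
  exact h (MulAction.stabilizer G x) (MulAction.stabilizer Q x)
    ((π.comp (Subgroup.subtype _)).codRestrict _ fun k => k.2) (fun _ => rfl) (h₄ x)

/-- The groups obtained from the virtually free abelian groups of finite rank by passing `n` times
to the groups that act on a finite-dimensional contractible complex. -/
def virtuallyFreeAbelianHierarchy : ℕ → GroupClass.{u}
  | 0 => virtuallyFreeAbelianGroups
  | n + 1 => actsWithStabilizersIn (virtuallyFreeAbelianHierarchy n)

/-- With trivial kernel every stabilizer meets `H` trivially, and is finite because `H` has finite
index. -/
theorem virtuallyFreeAbelianGroups.actsWithStabilizersIn_finiteGroups {G : Type u} [Group G]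
    (hG : virtuallyFreeAbelianGroups G) : actsWithStabilizersIn finiteGroups G := by
  obtain ⟨H, hH, n, χ, hχ⟩ := hG
  have hker : χ.ker = ⊥ := (MonoidHom.ker_eq_bot_iff χ).2 hχ
  have : Countable χ.ker := by
    rw [hker]
    infer_instance
  refine actsWithStabilizersIn_of_hom H χ _ fun K B _ hB hK => ?_
  rw [hker] at hB
  have hbot : H.subgroupOf K = ⊥ := by
    rw [Subgroup.subgroupOf_eq_bot, disjoint_comm, ← Subgroup.subgroupOf_eq_bot]
    exact le_bot_iff.1 (hK.trans hB)
  have hne := (inferInstance : (H.subgroupOf K).FiniteIndex).index_ne_zero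
  rw [hbot, Subgroup.index_bot] at hne
  exact Nat.finite_of_card_ne_zero hne

theorem hierarchy_of_virtuallyFreeAbelianHierarchy (n : ℕ) : ∀ (G : Type u) [Group G],
    virtuallyFreeAbelianHierarchy n G → hierarchy finiteGroups.{u} ((n + 1 : ℕ) : Ordinal.{u}) G := by
  induction n with
  | zero =>
    intro G _ hG
    rw [Nat.cast_succ, hierarchy_succ, Nat.cast_zero, hierarchy_zero]
    exact hG.actsWithStabilizersIn_finiteGroups
  | succ n ih =>
    intro G _ hG
    rw [Nat.cast_succ, hierarchy_succ]
    exact actsWithStabilizersIn_mono ih hG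

/-- In the base case each stabilizer has a finite-index subgroup inside a finitely generated
subgroup of the abelian kernel, so it is virtually free abelian. The inductive step pulls back the
complex of `Q`. Only countability of `G` is assumed, as stabilizers inherit it but need not be
finitely generated. -/
theorem virtuallyFreeAbelianHierarchy_of_hom (n : ℕ) : ∀ (G Q : Type u) [Group G] [Group Q]
    [Countable G] (π : G →* Q), (∀ a ∈ π.ker, ∀ b ∈ π.ker, a * b = b * a) →
    virtuallyFreeAbelianHierarchy n Q → virtuallyFreeAbelianHierarchy (n + 1) G := by
  induction n with
  | zero =>
    rintro G Q _ _ _ π hπ ⟨H, hH, n, χ, hχ⟩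
    have := H.finiteIndex_comap π
    refine actsWithStabilizersIn_of_hom (H.comap π) (χ.comp (π.subgroupComap H)) _
      fun K B hBfg hB hK => ?_
    have hker : ∀ b ∈ B, (b : G) ∈ π.ker := fun b hb =>
      congrArg Subtype.val (hχ ((hB hb).trans (map_one χ).symm))
    have hBc : virtuallyFreeAbelianGroups B :=
      .of_fg ((Group.fg_iff_subgroup_fg B).2 hBfg) fun a b =>
        Subtype.ext (Subtype.ext (hπ _ (hker a a.2) _ (hker b b.2)))
    refine .of_finiteIndex ((H.comap π).subgroupOf K) (.of_injective (MonoidHom.mk'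
      (fun k => (⟨⟨k.1.1, k.2⟩, hK k.1.2⟩ : B)) fun _ _ => rfl) (fun a b hab => ?_) hBc)
    exact Subtype.ext (Subtype.ext (congrArg (fun b : B => ((b : H.comap π) : G)) hab))
  | succ n ih =>
    intro G Q _ _ _ π hπ hQ
    refine actsWithStabilizersIn_of_pullback π (fun K L ρ hρ hL => ?_) hQ
    have hρker : ∀ k ∈ ρ.ker, (k : G) ∈ π.ker := fun k hk => by
      rw [MonoidHom.mem_ker, ← hρ, hk, Subgroup.coe_one]
    exact ih K L ρ (fun a ha b hb => Subtype.ext (hπ _ (hρker a ha) _ (hρker b hb))) hL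

theorem Group.FG.countable {G : Type*} [Group G] (hG : Group.FG G) : Countable G := by
  obtain ⟨s, hs⟩ := hG.out
  have : Function.Surjective (FreeGroup.lift ((↑) : s → G)) := by
    rw [← MonoidHom.range_eq_top, FreeGroup.range_lift_eq_closure]
    simpa using hs
  exact this.countable

theorem virtuallyFreeAbelianHierarchy_of_derivedSeries (n : ℕ) : ∀ (G : Type u) [Group G]
    [Group.FG G], derivedSeries G (n + 1) = ⊥ → virtuallyFreeAbelianHierarchy n G := by
  induction n with
  | zero =>
    intro G _ _ hG
    rw [zero_add, derivedSeries_succ, derivedSeries_zero,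
      Subgroup.commutator_eq_bot_iff_le_centralizer] at hG
    exact .of_fg ‹_› fun a b =>
      (Subgroup.mem_centralizer_iff.1 (hG (Subgroup.mem_top b)) a (Subgroup.mem_top a))
  | succ n ih =>
    intro G _ hfg hG
    have := hfg.countable
    have := derivedSeries_normal G (n + 1)
    refine virtuallyFreeAbelianHierarchy_of_hom n G (G ⧸ derivedSeries G (n + 1))
      (QuotientGroup.mk' _) (fun a ha b hb => ?_) (ih _ ?_)
    · rw [QuotientGroup.ker_mk'] at ha hb
      rw [derivedSeries_succ, Subgroup.commutator_eq_bot_iff_le_centralizer] at hG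
      exact Subgroup.mem_centralizer_iff.1 (hG hb) a ha
    · rw [← map_derivedSeries_eq (QuotientGroup.mk'_surjective (derivedSeries G (n + 1))),
        Subgroup.map_eq_bot_iff, QuotientGroup.ker_mk']

/-- Every finitely generated soluble group of derived length `d` belongs to `H_d 𝔉`. -/
theorem proposition2p7 (G : Type u) [Group G] [Group.FG G] [Group.IsSolvable G] (d : ℕ)
    (hd : derivedLength G = d) : hierarchy finiteGroups.{u} (d : Ordinal.{u}) G := by
  have h : derivedSeries G d = ⊥ := by
    rw [← hd]
    exact Nat.sInf_mem (s := {n : ℕ | derivedSeries G n = ⊥}) Group.IsSolvable.solvable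
  cases d with
  | zero =>
    rw [Nat.cast_zero, hierarchy_zero]
    rw [derivedSeries_zero] at h
    have : Subsingleton G := (Subgroup.subsingleton_iff).1 (subsingleton_of_bot_eq_top h.symm)
    exact Finite.of_subsingleton
  | succ n =>
    exact hierarchy_of_virtuallyFreeAbelianHierarchy n G
      (virtuallyFreeAbelianHierarchy_of_derivedSeries n G h)
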